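/- Let $B$ be a real separable Banach space and let $L=\{L_t\}_{t\ge 0}$ be a $B$-valued Lévy process on a probability space $(\Omega,\mathcal F,\mathbb P)$ (independent and stationary increments, stochastically continuous, almost surely càdlàg paths, $L_0=0$ a.s.), where $\mathcal F=\sigma\{L_t: t\ge 0\}$. Let $\mathcal N$ be the $\mathbb P$-null sets of $\mathcal F$ and, with $L_{u,v}=L_v-L_u$, put $\mathcal F_t=\sigma\{L_u: u\le t\}\vee\mathcal N$ and $\mathcal F_{s,t}=\sigma\{L_{u,v}: s\le u\le v\le t\}\vee\mathcal N$. (1) For all $s,t\ge 0$ the shift of cylindrical functions $$\tau(L_{t_0,t_1},\dots,L_{t_{n-1},t_n})\longmapsto \tau(L_{s+t_0,s+t_1},\dots,L_{s+t_{n-1},s+t_n}),\qquad 0=t_0\le t_1\le\dots\le t_n=t,\ \tau:B^n\to\mathbb C \text{ bounded measurable},$$ extends uniquely to a unitary $S_{s,t}:L^2(\Omega,\mathcal F_t,\mathbb P)\to L^2(\Omega,\mathcal F_{s,s+t},\mathbb P)$. If $\sigma_s:\Omega\to\Omega$ is measure preserving and for each $t\ge0$ satisfies $L_t\circ\sigma_s=L_{s+t}-L_s$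 a.s., then $S_{s,t}g=g\circ\sigma_s$ for all $t\ge 0$ and $g\in L^2(\Omega,\mathcal F_t,\mathbb P)$. (2) There is a unique family of unitaries $$U_{s,t}:L^2(\Omega,\mathcal F_s,\mathbb P)\otimes L^2(\Omega,\mathcal F_t,\mathbb P)\to L^2(\Omega,\mathcal F_{s+t},\mathbb P),\qquad U_{s,t}(f\otimes g)=f\cdot S_{s,t}g,\qquad s,t>0 .$$ It is associative: $U_{t_1,t_2+t_3}(\mathbf 1\otimes U_{t_2,t_3})=U_{t_1+t_2,t_3}(U_{t_1,t_2}\otimes\mathbf 1)$ for all $t_1,t_2,t_3>0$. (3) With the Borel structure inherited from $(0,\infty)\times L^2(\Omega,\mathcal F,\mathbb P)$, the bundle $E^L=\{(t,f): t>0,\ f\in L^2(\Omega,\mathcal F_t,\mathbb P)\}$ is a standard Borel space whose fibres are separable Hilbert spaces; the projection onto $(0,\infty)$, the vector space operations, the inner products and the multiplication $((s,f),(t,g))\mapsto (s+t,U_{s,t}(f\otimes g))$ are Borel, and on every fibre the induced structure is the Borel structure of the norm. (4) For every $\phi\in B^*$, the family $u^\phi(t)=\exp(i\langle\phi,L_t\rangle)$,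 $t>0$, is a unit: a non-zero Borel section of $E^L$ with $u^\phi(s+t)=U_{s,t}(u^\phi(s)\otimes u^\phi(t))$ for all $s,t>0$. (5) If $L$ is not deterministic (that is, for some $t$ the vector $L_t$ is not almost surely constant), then every fibre is infinite-dimensional and $E^L$ is isomorphic, as a measurable family of Hilbert spaces, to the trivial bundle $(0,\infty)\times\ell^2(\mathbb N)$. Hence $(E^L,U)$ is a product system of Hilbert spaces, and it is spatial, that is, it has a unit. -/

import Mathlib

open MeasureTheory ProbabilityTheory Filter Topology
open scoped NNReal ENNReal TensorProduct

noncomputable section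

/-! ### Banach space valued Lévy processes -/

/-- The random function `L` is a Lévy process under `P`. -/
structure IsLevyProcess {Ω B : Type*} [MeasurableSpace Ω] [NormedAddCommGroup B]
    [MeasurableSpace B] (L : ℝ≥0 → Ω → B) (P : Measure Ω) : Prop where
  measurable : ∀ t, Measurable (L t)
  indep_past : ∀ s t u : ℝ≥0, u ≤ t → IndepFun (fun ω => L (t + s) ω - L t ω) (L u) P
  stationary : ∀ s t : ℝ≥0, IdentDistrib (fun ω => L (t + s) ω - L t ω) (L s) P P
  indepIncrements : HasIndepIncrements L P
  stochContinuous : ∀ ε : ℝ, 0 < ε → ∀ s : ℝ≥0,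
    Tendsto (fun t : ℝ≥0 => P {ω | ε < ‖L (s + t) ω - L s ω‖}) (𝓝[>] 0) (𝓝 0)
  cadlag : ∀ᵐ ω ∂P, ∀ t : ℝ≥0,
    ContinuousWithinAt (fun u => L u ω) (Set.Ici t) t ∧
      ∃ l : B, Tendsto (fun u => L u ω) (𝓝[<] t) (𝓝 l)
  zero : ∀ᵐ ω ∂P, L 0 ω = 0

/-- The process is deterministic: each `L t` is almost surely equal to a constant vector. -/
def IsDeterministicProcess {Ω B : Type*} [MeasurableSpace Ω] (L : ℝ≥0 → Ω → B) (P : Measure Ω) : Prop :=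
  ∀ t, ∃ b : B, ∀ᵐ ω ∂P, L t ω = b

/-- `σ(L_t : t ≥ 0)`. -/
abbrev sigmaAll {Ω B : Type*} [MeasurableSpace B] (L : ℝ≥0 → Ω → B) : MeasurableSpace Ω :=
  ⨆ t : ℝ≥0, MeasurableSpace.comap (L t) inferInstance

/-- The σ-algebra generated by the null sets of the σ-algebra of `Ω`. -/
abbrev nullSigma {Ω : Type*} [MeasurableSpace Ω] (P : Measure Ω) : MeasurableSpace Ω :=
  MeasurableSpace.generateFrom {A | MeasurableSet A ∧ P A = 0}

/-- `F_t = σ(L_u : u ≤ t) ∨ N`. -/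
abbrev sigmaPast {Ω B : Type*} [MeasurableSpace Ω] [MeasurableSpace B] (L : ℝ≥0 → Ω → B)
    (P : Measure Ω) (t : ℝ≥0) : MeasurableSpace Ω :=
  (⨆ u : Set.Iic t, MeasurableSpace.comap (L u) inferInstance) ⊔ nullSigma P

/-- `F_{s,t} = σ(L_v - L_u : s ≤ u ≤ v ≤ t) ∨ N`. -/
abbrev sigmaIncr {Ω B : Type*} [MeasurableSpace Ω] [MeasurableSpace B] [Sub B] (L : ℝ≥0 → Ω → B)
    (P : Measure Ω) (s t : ℝ≥0) : MeasurableSpace Ω :=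
  (⨆ q : {q : ℝ≥0 × ℝ≥0 // s ≤ q.1 ∧ q.1 ≤ q.2 ∧ q.2 ≤ t},
    MeasurableSpace.comap (fun ω => L q.1.2 ω - L q.1.1 ω) inferInstance) ⊔ nullSigma P

/-- `L²(Ω, m, P)`, as a subspace of `L²(Ω, P)`, for a sub-σ-algebra `m`. -/
abbrev L2Sub {Ω : Type*} {mΩ : MeasurableSpace Ω} (P : @Measure Ω mΩ) (m : MeasurableSpace Ω) :
    Submodule ℂ (@Lp Ω ℂ mΩ _ 2 P) :=
  @lpMeas Ω ℂ ℂ _ _ _ m mΩ 2 P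

/-- The increments `(L_{r + p_{i+1}} - L_{r + p_i})_{i < n}`. -/
def increments {Ω B : Type*} [Sub B] (L : ℝ≥0 → Ω → B) (r : ℝ≥0) {n : ℕ} (p : Fin (n + 1) → ℝ≥0)
    (ω : Ω) : Fin n → B :=
  fun i => L (r + p i.succ) ω - L (r + p i.castSucc) ω

/-- Families of unitaries `L²(F_t) → L²(F_{s,s+t})`, `s, t ≥ 0`. -/
abbrev ShiftFamily {Ω B : Type*} [MeasurableSpace Ω] [MeasurableSpace B] [Sub B]
    (L : ℝ≥0 → Ω → B) (P : Measure Ω) : Type _ :=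
  ∀ s t : ℝ≥0, L2Sub P (sigmaPast L P t) ≃ₗᵢ[ℂ] L2Sub P (sigmaIncr L P s (s + t))

/-- The unitaries `S s t` extend the shift of cylindrical functions
`τ(L_{t₀,t₁}, …, L_{tₙ₋₁,tₙ}) ↦ τ(L_{s+t₀,s+t₁}, …, L_{s+tₙ₋₁,s+tₙ})`, for all
`0 = t₀ ≤ t₁ ≤ ⋯ ≤ tₙ = t` and all bounded measurable `τ : Bⁿ → ℂ`. -/
def IsShiftFamily {Ω B : Type*} [MeasurableSpace Ω] [MeasurableSpace B] [Sub B]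
    (L : ℝ≥0 → Ω → B) (P : Measure Ω) (S : ShiftFamily L P) : Prop :=
  ∀ (s t : ℝ≥0) (n : ℕ) (p : Fin (n + 1) → ℝ≥0), Monotone p → p 0 = 0 → p (Fin.last n) = t →
    ∀ τ : (Fin n → B) → ℂ, Measurable τ → (∃ C : ℝ, ∀ x, ‖τ x‖ ≤ C) →
      ∀ f : L2Sub P (sigmaPast L P t),
        ((f : Lp ℂ 2 P) : Ω → ℂ) =ᵐ[P] (fun ω => τ (increments L 0 p ω)) →
        ((S s t f : Lp ℂ 2 P) : Ω → ℂ) =ᵐ[P] (fun ω => τ (increments L s p ω))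

/-! ### Product systems of Hilbert spaces -/

/-- The time set `(0, ∞)`. -/
abbrev PosTime : Type := {t : ℝ≥0 // 0 < t}

/-- The Hilbert space tensor product. -/
abbrev HilbertTensor (H K : Type*) [NormedAddCommGroup H] [InnerProductSpace ℂ H]
    [NormedAddCommGroup K] [InnerProductSpace ℂ K] : Type _ :=
  UniformSpace.Completion (H ⊗[ℂ] K)

/-- The elementary tensor `x ⊗ y` in the Hilbert space tensor product. -/
def pureTensor {H K : Type*} [NormedAddCommGroup H] [InnerProductSpace ℂ H]
    [NormedAddCommGroup K] [InnerProductSpace ℂ K] (x : H) (y : K) : HilbertTensor H K :=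
  ((x ⊗ₜ[ℂ] y : H ⊗[ℂ] K) : UniformSpace.Completion (H ⊗[ℂ] K))

/-- The Hilbert space `ℓ²(ℕ)`, with its Borel structure. -/
abbrev Ell2 : Type := lp (fun _ : ℕ => ℂ) 2

instance : MeasurableSpace Ell2 := borel Ell2
instance : BorelSpace Ell2 := ⟨rfl⟩

/-- The total space `{(t, x) | x ∈ E(t), t > 0}` of a bundle over `(0, ∞)`. -/
@[ext] structure TotalSpace (E : PosTime → Type*) where
  time : PosTime
  vec : E time

/-- The fibre product `{(t, x, y) | x, y ∈ E(t), t > 0}`. -/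
@[ext] structure FibrePairs (E : PosTime → Type*) where
  time : PosTime
  left : E time
  right : E time

/-- The fibre product carries the Borel structure of a subset of the square of the total space. -/
instance (E : PosTime → Type*) [MeasurableSpace (TotalSpace E)] : MeasurableSpace (FibrePairs E) :=
  MeasurableSpace.comap
    (fun q => ((⟨q.time, q.left⟩, ⟨q.time, q.right⟩) : TotalSpace E × TotalSpace E)) inferInstance

section ProductSystem

variable {E : PosTime → Type*} [∀ t, NormedAddCommGroup (E t)] [∀ t, InnerProductSpace ℂ (E t)]

/-- The multiplication `(s, x) (t, y) = (s + t, U_{s,t}(x ⊗ y))` on the total space. -/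
def bundleMul (U : ∀ s t : PosTime, HilbertTensor (E s) (E t) ≃ₗᵢ[ℂ] E (s + t))
    (a b : TotalSpace E) : TotalSpace E :=
  ⟨a.time + b.time, U a.time b.time (pureTensor a.vec b.vec)⟩

/-- A standard Borel bundle of separable Hilbert spaces over `(0, ∞)` with a measurable
associative family of unitaries `U_{s,t} : E(s) ⊗ E(t) → E(s + t)`. All operators in the
associativity relation being bounded and linear, it is stated on elementary tensors. -/
structure IsMultiplicativeBundle [MeasurableSpace (TotalSpace E)]
    (U : ∀ s t : PosTime, HilbertTensor (E s) (E t) ≃ₗᵢ[ℂ] E (s + t)) : Prop where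
  complete : ∀ t, CompleteSpace (E t)
  separable : ∀ t, TopologicalSpace.SeparableSpace (E t)
  standardBorel : StandardBorelSpace (TotalSpace E)
  measurable_time : Measurable (TotalSpace.time : TotalSpace E → PosTime)
  /-- On each fibre the structure induced by the total space is the Borel structure of the norm. -/
  fibre_embedding : ∀ t, @MeasurableEmbedding (E t) (TotalSpace E) (borel (E t)) _ (TotalSpace.mk t)
  measurable_smul : Measurable (fun q : ℂ × TotalSpace E =>
    (⟨q.2.time, q.1 • q.2.vec⟩ : TotalSpace E))
  measurable_add : Measurable (fun q : FibrePairs E =>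
    (⟨q.time, q.left + q.right⟩ : TotalSpace E))
  measurable_inner : Measurable (fun q : FibrePairs E => inner ℂ q.left q.right)
  measurable_mul : Measurable (fun q : TotalSpace E × TotalSpace E => bundleMul U q.1 q.2)
  assoc : ∀ a b c : TotalSpace E,
    bundleMul U a (bundleMul U b c) = bundleMul U (bundleMul U a b) c

/-- Product systems: multiplicative bundles with infinite-dimensional fibres which are isomorphic,
as measurable families of Hilbert spaces, to the trivial bundle `(0, ∞) × ℓ²(ℕ)`. -/
structure IsProductSystem [MeasurableSpace (TotalSpace E)]
    (U : ∀ s t : PosTime, HilbertTensor (E s) (E t) ≃ₗᵢ[ℂ] E (s + t)) : Prop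
    extends IsMultiplicativeBundle U where
  infinite_dim : ∀ t, ¬ FiniteDimensional ℂ (E t)
  trivializable : ∃ (V : ∀ t, E t ≃ₗᵢ[ℂ] Ell2) (Φ : TotalSpace E ≃ᵐ PosTime × Ell2),
    ∀ x : TotalSpace E, Φ x = (x.time, V x.time x.vec)

/-- Units: non-zero Borel sections with `u(s + t) = u(s) u(t)`. -/
structure IsProductUnit [MeasurableSpace (TotalSpace E)]
    (U : ∀ s t : PosTime, HilbertTensor (E s) (E t) ≃ₗᵢ[ℂ] E (s + t)) (u : ∀ t, E t) : Prop where
  measurable : Measurable (fun t => (⟨t, u t⟩ : TotalSpace E))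
  ne_zero : ∃ t, u t ≠ 0
  mul : ∀ s t : PosTime, u (s + t) = U s t (pureTensor (u s) (u t))

/-- Spatial product systems: those that have a unit. -/
structure IsSpatialProductSystem [MeasurableSpace (TotalSpace E)]
    (U : ∀ s t : PosTime, HilbertTensor (E s) (E t) ≃ₗᵢ[ℂ] E (s + t)) : Prop
    extends IsProductSystem U where
  exists_unit : ∃ u : ∀ t, E t, IsProductUnit U u

end ProductSystem

/-! ### The bundle of a Lévy process -/

section LevyBundle

variable {Ω B : Type*} [MeasurableSpace Ω] [MeasurableSpace B]

instance (P : Measure Ω) : MeasurableSpace (Lp ℂ 2 P) := borel _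
instance (P : Measure Ω) : BorelSpace (Lp ℂ 2 P) := ⟨rfl⟩

/-- The fibre `L²(Ω, F_t, P)`. -/
abbrev levyFibre (L : ℝ≥0 → Ω → B) (P : Measure Ω) (t : PosTime) : Type _ :=
  L2Sub P (sigmaPast L P t)

/-- The bundle carries the Borel structure of a subset of `(0, ∞) × L²(Ω, P)`. -/
instance (L : ℝ≥0 → Ω → B) (P : Measure Ω) : MeasurableSpace (TotalSpace (levyFibre L P)) :=
  MeasurableSpace.comap (fun x => ((x.time, (x.vec : Lp ℂ 2 P)) : PosTime × Lp ℂ 2 P)) inferInstance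

/-- `U_{s,t}(f ⊗ g) = f · S_{s,t} g`. -/
def IsLevyMultiplication [Sub B] (L : ℝ≥0 → Ω → B) (P : Measure Ω) (S : ShiftFamily L P)
    (U : ∀ s t : PosTime,
      HilbertTensor (levyFibre L P s) (levyFibre L P t) ≃ₗᵢ[ℂ] levyFibre L P (s + t)) : Prop :=
  ∀ (s t : PosTime) (f : levyFibre L P s) (g : levyFibre L P t),
    ((U s t (pureTensor f g) : Lp ℂ 2 P) : Ω → ℂ) =ᵐ[P]
      fun ω => ((f : Lp ℂ 2 P) : Ω → ℂ) ω * ((S s t g : Lp ℂ 2 P) : Ω → ℂ) ω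

end LevyBundle

end

/-!
The law of the path `u ↦ L (s + u) - L s` does not depend on `s`, so the two pullbacks from its
`L²`-space, along this path and along the path for `s = 0`, are isometries; the second one is onto
`L²(Ω, P)`, and the shift is the first one after the inverse of the second. Independence of the
increments makes `f ⊗ g ↦ f · S_s g` isometric, and it is onto because products of indicators of a
past event and a future event are total.

Right continuity of the paths makes `L²(Ω, P)` separable and the shift strongly continuous, which
yields the Borel properties. Since `L²(F_t)` grows with `t`, the orthogonal projections onto the
fibres are measurable in `t`, and Gram–Schmidt applied to the projections of a dense sequence
trivializes the bundle as soon as all fibres are infinite-dimensional. If some fibre had finite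
dimension, `dim L²(F_t)² ≤ dim L²(F_{2t})` would force dimension at most one at a small time; then
`F_t` is trivial modulo null sets, so `L` is almost surely constant up to time `t`, and by doubling
at all times.
-/

section SubspacesOfL2

variable {Ω : Type*} {m mΩ : MeasurableSpace Ω} {P : Measure Ω}

theorem nullSigma_le : nullSigma P ≤ mΩ :=
  MeasurableSpace.generateFrom_le fun _ hA => hA.1

theorem nullSigma_le_eventuallyMeasurableSpace :
    nullSigma P ≤ eventuallyMeasurableSpace m (ae P) :=
  MeasurableSpace.generateFrom_le fun _ hA => ⟨∅, @MeasurableSet.empty _ m, ae_eq_empty.2 hA.2⟩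

theorem comap_le_eventuallyMeasurableSpace {β : Type*} [mβ : MeasurableSpace β] {f g : Ω → β}
    (hg : Measurable[m] g) (hfg : f =ᵐ[P] g) :
    mβ.comap f ≤ eventuallyMeasurableSpace m (ae P) := by
  rintro _ ⟨C, hC, rfl⟩
  exact ⟨g ⁻¹' C, hg hC, hfg.preimage C⟩

theorem mem_L2Sub_of_ae_eq {f : Lp ℂ 2 P} {g : Ω → ℂ} (hg : Measurable[m] g) (h : f =ᵐ[P] g) :
    f ∈ L2Sub P m :=
  mem_lpMeas_iff_aestronglyMeasurable.2 ⟨g, hg.stronglyMeasurable, h⟩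

theorem isClosed_L2Sub (hm : m ≤ mΩ) : IsClosed (L2Sub P m : Set (Lp ℂ 2 P)) :=
  have : Fact (m ≤ mΩ) := ⟨hm⟩
  isClosed_aestronglyMeasurable hm

section Pullback

variable {𝒴 : Type*} [m𝒴 : MeasurableSpace 𝒴] {Y : Ω → 𝒴}

/-- Composition with a measure preserving map, as an isometry of `L²`-spaces. -/
noncomputable abbrev pullbackL2 {Q : Measure 𝒴} (hY : MeasurePreserving Y P Q) :
    Lp ℂ 2 Q →ₗᵢ[ℂ] Lp ℂ 2 P :=
  Lp.compMeasurePreservingₗᵢ ℂ Y hY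

theorem pullbackL2_coeFn {Q : Measure 𝒴} (hY : MeasurePreserving Y P Q) (g : Lp ℂ 2 Q) :
    pullbackL2 hY g =ᵐ[P] g ∘ Y :=
  Lp.coeFn_compMeasurePreserving g hY

theorem setIntegral_preimage_eq_zero {E : Type*} [NormedAddCommGroup E] [NormedSpace ℝ E]
    {f : Ω → E} (hf : Integrable f P) (hY : Measurable Y) {𝒞 : Set (Set 𝒴)}
    (hpi : IsPiSystem 𝒞) (hgen : m𝒴 = MeasurableSpace.generateFrom 𝒞)
    (huniv : Set.univ ∈ 𝒞) (h : ∀ C ∈ 𝒞, ∫ ω in Y ⁻¹' C, f ω ∂P = 0) {C : Set 𝒴}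
    (hC : MeasurableSet C) : ∫ ω in Y ⁻¹' C, f ω ∂P = 0 := by
  induction C, hC using MeasurableSpace.induction_on_inter hgen hpi with
  | empty => simp
  | basic C hC => exact h C hC
  | compl C hC ih =>
    rw [Set.preimage_compl, setIntegral_compl (hY hC) hf, ih, sub_zero, ← setIntegral_univ]
    exact h _ huniv
  | iUnion C hd hC ih =>
    rw [Set.preimage_iUnion, integral_iUnion (fun i => hY (hC i))
      (fun i j hij => (hd hij).preimage Y) hf.integrableOn]
    simp [ih]

variable [IsFiniteMeasure P]

/-- The indicator function of a measurable set, as an element of `L²`. -/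
noncomputable abbrev indicatorL2 (P : Measure Ω) [IsFiniteMeasure P] {A : Set Ω}
    (hA : MeasurableSet A) : Lp ℂ 2 P :=
  indicatorConstLp 2 hA (measure_ne_top P A) 1

theorem indicatorL2_preimage_mem (hY : Measurable Y) {𝒞 : Set (Set 𝒴)} (hpi : IsPiSystem 𝒞)
    (hgen : m𝒴 = MeasurableSpace.generateFrom 𝒞) (huniv : Set.univ ∈ 𝒞)
    {V : Submodule ℂ (Lp ℂ 2 P)} (hV : IsClosed (V : Set (Lp ℂ 2 P)))
    (h : ∀ C ∈ 𝒞, ∀ hC : MeasurableSet C, indicatorL2 P (hY hC) ∈ V) {C : Set 𝒴}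
    (hC : MeasurableSet C) : indicatorL2 P (hY hC) ∈ V := by
  have : CompleteSpace V := hV.completeSpace_coe
  rw [← V.orthogonal_orthogonal, Submodule.mem_orthogonal']
  intro f hf
  rw [L2.inner_indicatorConstLp_one]
  refine setIntegral_preimage_eq_zero ((Lp.memLp f).integrable one_le_two) hY hpi hgen huniv
    (fun C hC => ?_) hC
  have hC' : MeasurableSet C := hgen ▸ MeasurableSpace.measurableSet_generateFrom hC
  rw [← L2.inner_indicatorConstLp_one (𝕜 := ℂ) (hY hC') (measure_ne_top _ _)]
  exact (V.mem_orthogonal f).1 hf _ (h C hC hC')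

theorem L2Sub_le_of_indicatorL2_mem (hY : Measurable Y) (hm : m ≤ mΩ)
    (hmY : m ≤ eventuallyMeasurableSpace (m𝒴.comap Y) (ae P)) {𝒞 : Set (Set 𝒴)}
    (hpi : IsPiSystem 𝒞) (hgen : m𝒴 = MeasurableSpace.generateFrom 𝒞) (huniv : Set.univ ∈ 𝒞)
    {V : Submodule ℂ (Lp ℂ 2 P)} (hV : IsClosed (V : Set (Lp ℂ 2 P)))
    (h : ∀ C ∈ 𝒞, ∀ hC : MeasurableSet C, indicatorL2 P (hY hC) ∈ V) : L2Sub P m ≤ V := by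
  intro f hf
  refine Lp.induction_stronglyMeasurable hm ENNReal.ofNat_ne_top (· ∈ V) ?_
    (fun _ _ _ _ _ _ _ => V.add_mem) (hV.preimage continuous_subtype_val) f
    (mem_lpMeas_iff_aestronglyMeasurable.1 hf)
  intro c A hA hPA
  obtain ⟨_, ⟨C, hC, rfl⟩, hAC⟩ := hmY A hA
  have : (Lp.simpleFunc.indicatorConst 2 (hm A hA) hPA.ne c : Lp ℂ 2 P) =
      c • indicatorL2 P (hY hC) := by
    rw [Lp.simpleFunc.coe_indicatorConst]
    refine Lp.ext (indicatorConstLp_coeFn.trans ?_)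
    filter_upwards [Lp.coeFn_smul c (indicatorL2 P (hY hC)),
      indicatorConstLp_coeFn (p := 2) (hs := hY hC) (hμs := measure_ne_top P _) (c := (1 : ℂ)),
      indicator_ae_eq_of_ae_eq_set (f := fun _ => c) hAC] with ω hsmul hind hA
    rw [hsmul, Pi.smul_apply, hind, hA, ← Set.indicator_const_smul_apply]
    simp
  rw [this]
  exact V.smul_mem c (indicatorL2_preimage_mem hY hpi hgen huniv hV h hC)

theorem L2Sub_le_range_pullbackL2 {Q : Measure 𝒴} (hY : MeasurePreserving Y P Q) (hm : m ≤ mΩ)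
    (hmY : m ≤ eventuallyMeasurableSpace (m𝒴.comap Y) (ae P)) :
    L2Sub P m ≤ (pullbackL2 hY).range := by
  have : IsFiniteMeasure Q := hY.map_eq ▸ inferInstance
  refine L2Sub_le_of_indicatorL2_mem hY.measurable hm hmY MeasurableSpace.isPiSystem_measurableSet
    MeasurableSpace.generateFrom_measurableSet.symm MeasurableSet.univ
    (pullbackL2 hY).isometry.isClosedEmbedding.isClosed_range fun C _ hC => ?_
  exact ⟨indicatorL2 Q hC, Lp.indicatorConstLp_compMeasurePreserving hC (measure_ne_top _ _) _ hY⟩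

theorem exists_measurable_comp_of_mem_L2Sub (hY : Measurable Y) (hm : m ≤ mΩ)
    (hmY : m ≤ eventuallyMeasurableSpace (m𝒴.comap Y) (ae P)) {f : Lp ℂ 2 P}
    (hf : f ∈ L2Sub P m) : ∃ h : 𝒴 → ℂ, Measurable h ∧ f =ᵐ[P] h ∘ Y := by
  obtain ⟨g, rfl⟩ := L2Sub_le_range_pullbackL2 (hY.measurePreserving P) hm hmY hf
  exact ⟨g, (Lp.stronglyMeasurable g).measurable, pullbackL2_coeFn _ g⟩

end Pullback

end SubspacesOfL2

section BoundedContinuous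

open scoped BoundedContinuousFunction

variable {Ω : Type*} {m mΩ : MeasurableSpace Ω} {P : Measure Ω} [IsFiniteMeasure P]

theorem memLp_boundedContinuous_comp {E : Type*} [TopologicalSpace E] [MeasurableSpace E]
    [OpensMeasurableSpace E] (φ : E →ᵇ ℂ) {X : Ω → E} (hX : Measurable X) (p : ℝ≥0∞) :
    MemLp (fun ω => φ (X ω)) p P :=
  .of_bound (φ.continuous.measurable.comp hX).aestronglyMeasurable ‖φ‖
    (.of_forall fun _ => φ.norm_coe_le_norm _)

theorem indicatorL2_mem_of_boundedContinuous {E : Type*} [TopologicalSpace E]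
    [TopologicalSpace.MetrizableSpace E] [MeasurableSpace E] [BorelSpace E] {X : Ω → E}
    (hX : Measurable X) {V : Submodule ℂ (Lp ℂ 2 P)}
    (hV : IsClosed (V : Set (Lp ℂ 2 P)))
    (h : ∀ φ : E →ᵇ ℂ, (memLp_boundedContinuous_comp φ hX 2).toLp _ ∈ V) {A : Set E}
    (hA : MeasurableSet A) : indicatorL2 P (hX hA) ∈ V := by
  have hX' := hX.measurePreserving P
  have hmem (g : Lp ℂ 2 (P.map X)) : pullbackL2 hX' g ∈ V := by
    refine (BoundedContinuousFunction.toLp_denseRange (p := 2) ℂ (P.map X) ℂ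
      ENNReal.ofNat_ne_top).induction_on g (hV.preimage (pullbackL2 hX').continuous) fun φ => ?_
    convert h φ
    refine Lp.ext ((pullbackL2_coeFn hX' _).trans (EventuallyEq.trans ?_ (MemLp.coeFn_toLp _).symm))
    exact hX'.quasiMeasurePreserving.ae_eq_comp (BoundedContinuousFunction.coeFn_toLp 2 _ ℂ φ)
  convert hmem (indicatorL2 _ hA)
  exact (Lp.indicatorConstLp_compMeasurePreserving hA (measure_ne_top _ _) _ hX').symm

theorem L2Sub_le_of_boundedContinuous {ι B : Type*} [TopologicalSpace B]
    [TopologicalSpace.MetrizableSpace B] [SecondCountableTopology B] [MeasurableSpace B]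
    [BorelSpace B] {Y : Ω → ι → B} (hY : Measurable Y) (hm : m ≤ mΩ)
    (hmY : m ≤ eventuallyMeasurableSpace (MeasurableSpace.pi.comap Y) (ae P))
    {V : Submodule ℂ (Lp ℂ 2 P)} (hV : IsClosed (V : Set (Lp ℂ 2 P)))
    (h : ∀ (I : Finset ι) (φ : (I → B) →ᵇ ℂ),
      (memLp_boundedContinuous_comp φ ((Finset.measurable_restrict I).comp hY) 2).toLp _ ∈ V) :
    L2Sub P m ≤ V := by
  refine L2Sub_le_of_indicatorL2_mem hY hm hmY isPiSystem_measurableCylinders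
    generateFrom_measurableCylinders.symm (univ_mem_measurableCylinders _) hV ?_
  intro C hC _
  obtain ⟨I, A, hA, rfl⟩ := (mem_measurableCylinders C).1 hC
  exact indicatorL2_mem_of_boundedContinuous ((Finset.measurable_restrict I).comp hY) hV (h I) hA

theorem tendsto_toLp_boundedContinuous_comp {E ι : Type*} [TopologicalSpace E]
    [MeasurableSpace E] [OpensMeasurableSpace E] {l : Filter ι} [l.IsCountablyGenerated]
    (φ : E →ᵇ ℂ) {X : ι → Ω → E} {X₀ : Ω → E} (hX : ∀ i, Measurable (X i)) (hX₀ : Measurable X₀)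
    (h : ∀ᵐ ω ∂P, Tendsto (fun i => X i ω) l (𝓝 (X₀ ω))) :
    Tendsto (fun i => (memLp_boundedContinuous_comp φ (hX i) 2).toLp _ : ι → Lp ℂ 2 P) l
      (𝓝 ((memLp_boundedContinuous_comp φ hX₀ 2).toLp _)) := by
  rw [Lp.tendsto_Lp_iff_tendsto_eLpNorm'']
  simp_rw [eLpNorm_eq_lintegral_rpow_enorm_toReal two_ne_zero ENNReal.ofNat_ne_top]
  have hlim : Tendsto (fun i => ∫⁻ ω, ‖φ (X i ω) - φ (X₀ ω)‖ₑ ^ (2 : ℝ≥0∞).toReal ∂P) l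
      (𝓝 (∫⁻ _, 0 ∂P)) := by
    refine tendsto_lintegral_filter_of_dominated_convergence
      (fun _ => (ENNReal.ofReal (‖φ‖ + ‖φ‖)) ^ (2 : ℝ≥0∞).toReal) (.of_forall fun i => ?_)
      (.of_forall fun i => .of_forall fun ω => ?_) ?_ ?_
    · have := φ.continuous.measurable
      fun_prop
    · gcongr
      rw [← ofReal_norm]
      exact ENNReal.ofReal_le_ofReal (norm_sub_le_of_le (φ.norm_coe_le_norm _)
        (φ.norm_coe_le_norm _))
    · simp [lintegral_const, ENNReal.mul_eq_top]
    · filter_upwards [h] with ω hω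
      have := (((φ.continuous.tendsto _).comp hω).sub_const (φ (X₀ ω))).enorm
      simpa using! this.ennrpow_const (2 : ℝ≥0∞).toReal
  simpa using! hlim.ennrpow_const (1 / (2 : ℝ≥0∞).toReal)

end BoundedContinuous

section Partitions

theorem sum_filter_succ_sub_castSucc {G : Type*} [AddCommGroup G] {n : ℕ} (f : Fin (n + 1) → G)
    {j k : Fin (n + 1)} (hjk : j ≤ k) :
    ∑ i : Fin n with j ≤ i.castSucc ∧ i.castSucc < k, (f i.succ - f i.castSucc) = f k - f j := by
  induction k using Fin.induction with
  | zero => simp [Fin.le_zero_iff.1 hjk]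
  | succ k ih =>
    obtain rfl | hjk := hjk.eq_or_lt
    · rw [Finset.filter_false_of_mem (fun _ _ h => (h.1.trans_lt h.2).false), Finset.sum_empty,
        sub_self]
    · rw [← Fin.le_castSucc_iff] at hjk
      have : Finset.univ.filter (fun i : Fin n => j ≤ i.castSucc ∧ i.castSucc < k.succ) =
          insert k (Finset.univ.filter fun i => j ≤ i.castSucc ∧ i.castSucc < k.castSucc) := by
        ext i
        simp only [Finset.mem_filter, Finset.mem_univ, true_and, Finset.mem_insert]
        grind
      rw [this, Finset.sum_insert (by simp), ih hjk, sub_add_sub_cancel]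

theorem exists_partition {t : ℝ≥0} (K : Finset ℝ≥0) (hK : ∀ u ∈ K, u ≤ t) :
    ∃ (n : ℕ) (p : Fin (n + 1) → ℝ≥0), StrictMono p ∧ p 0 = 0 ∧ p (Fin.last n) = t ∧
      ∀ u ∈ K, ∃ k, p k = u := by
  classical
  obtain ⟨n, hn⟩ : ∃ n, (insert 0 (insert t K)).card = n + 1 :=
    Nat.exists_eq_succ_of_ne_zero (Finset.card_ne_zero_of_mem (Finset.mem_insert_self 0 _))
  set p := (insert 0 (insert t K)).orderEmbOfFin hn
  have hrange (u : ℝ≥0) : (∃ k, p k = u) ↔ u = 0 ∨ u = t ∨ u ∈ K := by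
    rw [← Set.mem_range, Finset.range_orderEmbOfFin]
    simp
  obtain ⟨k₀, hk₀⟩ := (hrange 0).2 (.inl rfl)
  obtain ⟨k₁, hk₁⟩ := (hrange t).2 (.inr (.inl rfl))
  refine ⟨n, p, p.strictMono, ?_, le_antisymm ?_ ?_, fun u hu => (hrange u).2 (.inr (.inr hu))⟩
  · exact nonpos_iff_eq_zero.1 (hk₀ ▸ p.monotone (Fin.zero_le k₀))
  · rcases (hrange (p (Fin.last n))).1 ⟨_, rfl⟩ with h | h | h
    · exact h.trans_le zero_le
    · exact h.le
    · exact hK _ h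
  · exact hk₁ ▸ p.monotone (Fin.le_last k₁)

end Partitions

section Paths

variable {Ω B : Type*} [NormedAddCommGroup B]

/-- The path `u ↦ L (s + u) - L s`, `u ∈ T`, of the process `L` restarted at time `s`. -/
def incrPath (L : ℝ≥0 → Ω → B) (s : ℝ≥0) (T : Set ℝ≥0) (ω : Ω) : T → B :=
  fun u => L (s + u) ω - L s ω

theorem incrPath_eq_sum_increments (L : ℝ≥0 → Ω → B) (s : ℝ≥0) {T : Set ℝ≥0} (ω : Ω) {n : ℕ}
    {p : Fin (n + 1) → ℝ≥0} (hp0 : p 0 = 0) {k : Fin (n + 1)} {u : T} (hk : p k = u) :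
    incrPath L s T ω u = ∑ i : Fin n with i.castSucc < k, increments L s p ω i := by
  simpa only [Fin.zero_le, true_and, hp0, hk, add_zero] using!
    (sum_filter_succ_sub_castSucc (fun i => L (s + p i) ω) (Fin.zero_le k)).symm

variable [MeasurableSpace B]

theorem IsLevyProcess.iIndepFun_increments [MeasurableSpace Ω] {P : Measure Ω}
    {L : ℝ≥0 → Ω → B} (hL : IsLevyProcess L P) (s : ℝ≥0) {n : ℕ} {p : Fin (n + 1) → ℝ≥0}
    (hp : Monotone p) : iIndepFun (fun (i : Fin n) ω => increments L s p ω i) P :=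
  hL.indepIncrements n (fun i => s + p i) fun _ _ hij => by simpa using hp hij

theorem IsLevyProcess.identDistrib_increments [MeasurableSpace Ω] {P : Measure Ω}
    {L : ℝ≥0 → Ω → B} (hL : IsLevyProcess L P) (s r : ℝ≥0) {n : ℕ} {p : Fin (n + 1) → ℝ≥0}
    (hp : Monotone p) :
    IdentDistrib (increments L s p) (increments L r p) P P := by
  have hincr (s : ℝ≥0) (i : Fin n) : IdentDistrib (fun ω => increments L s p ω i)
      (L (p i.succ - p i.castSucc)) P P := by
    have := hL.stationary (p i.succ - p i.castSucc) (s + p i.castSucc)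
    rwa [add_assoc, add_tsub_cancel_of_le (hp i.castSucc_le_succ)] at this
  exact IdentDistrib.pi (fun i => (hincr s i).trans (hincr r i).symm)
    (hL.iIndepFun_increments s hp) (hL.iIndepFun_increments r hp)

variable [BorelSpace B] [SecondCountableTopology B]

theorem exists_restrict_incrPath_eq_increments {T : Set ℝ≥0} {t : ℝ≥0} (I : Finset T)
    (hI : ∀ u ∈ I, u ≤ t) :
    ∃ (n : ℕ) (p : Fin (n + 1) → ℝ≥0), Monotone p ∧ p 0 = 0 ∧ p (Fin.last n) = t ∧
      ∃ φ : (Fin n → B) → I → B, Measurable φ ∧ ∀ (L : ℝ≥0 → Ω → B) (s : ℝ≥0) (ω : Ω),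
        I.restrict (incrPath L s T ω) = φ (increments L s p ω) := by
  classical
  obtain ⟨n, p, hp, hp0, hpt, hK⟩ := exists_partition (I.image (↑)) (t := t) (by simpa using! hI)
  choose k hk using fun u : I => hK u (Finset.mem_image_of_mem _ u.2)
  refine ⟨n, p, hp.monotone, hp0, hpt, fun x u => ∑ i with i.castSucc < k u, x i, by fun_prop,
    fun L s ω => funext fun u => ?_⟩
  exact incrPath_eq_sum_increments L s ω hp0 (hk u)

namespace IsLevyProcess

variable [mΩ : MeasurableSpace Ω] {P : Measure Ω} {L : ℝ≥0 → Ω → B}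

theorem measurable_incrPath (hL : IsLevyProcess L P) (s : ℝ≥0) (T : Set ℝ≥0) :
    Measurable (incrPath L s T) :=
  measurable_pi_lambda _ fun _ => (hL.measurable _).sub (hL.measurable _)

theorem measurable_increments (hL : IsLevyProcess L P) (s : ℝ≥0) {n : ℕ}
    (p : Fin (n + 1) → ℝ≥0) (i : Fin n) : Measurable fun ω => increments L s p ω i :=
  (hL.measurable _).sub (hL.measurable _)

theorem map_incrPath [IsFiniteMeasure P] (hL : IsLevyProcess L P) (s r : ℝ≥0) (T : Set ℝ≥0) :
    P.map (incrPath L s T) = P.map (incrPath L r T) := by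
  refine (map_eq_iff_forall_finset_map_restrict_eq (hL.measurable_incrPath s T).aemeasurable
    (hL.measurable_incrPath r T).aemeasurable).2 fun I => ?_
  obtain ⟨n, p, hp, -, -, φ, hφ, h⟩ := exists_restrict_incrPath_eq_increments (Ω := Ω) (B := B)
    (t := I.sup (↑)) I fun u hu => Finset.le_sup (f := fun u : T => (u : ℝ≥0)) hu
  simpa only [h] using! ((hL.identDistrib_increments s r hp).comp hφ).map_eq

theorem measurePreserving_incrPath [IsFiniteMeasure P] (hL : IsLevyProcess L P) (s : ℝ≥0)
    (T : Set ℝ≥0) :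
    MeasurePreserving (incrPath L s T) P (P.map (incrPath L 0 T)) :=
  ⟨hL.measurable_incrPath s T, hL.map_incrPath s 0 T⟩

theorem indepFun_incrPath [IsZeroOrProbabilityMeasure P] (hL : IsLevyProcess L P) (s : ℝ≥0)
    (T : Set ℝ≥0) :
    IndepFun (incrPath L 0 (Set.Iic s)) (incrPath L s T) P := by
  classical
  refine IndepFun.process_indepFun_process (X := fun u ω => incrPath L 0 (Set.Iic s) ω u)
    (Y := fun u ω => incrPath L s T ω u)
    (fun u => (measurable_pi_apply u).comp (hL.measurable_incrPath 0 _))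
    (fun u => (measurable_pi_apply u).comp (hL.measurable_incrPath s _)) fun I J => ?_
  set K : Finset ℝ≥0 := insert s (I.image (↑) ∪ J.image (s + ↑·))
  obtain ⟨n, p, hp, hp0, -, hK⟩ := exists_partition (t := K.sup id) K
    fun u hu => Finset.le_sup (f := id) hu
  obtain ⟨j, hj⟩ := hK s (by simp [K])
  let m (i : Fin n) : MeasurableSpace Ω := .comap (fun ω => increments L 0 p ω i) inferInstance
  have hindep : Indep (⨆ i ∈ {i : Fin n | i.castSucc < j}, m i)
      (⨆ i ∈ {i : Fin n | j ≤ i.castSucc}, m i) P :=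
    indep_iSup_of_disjoint (fun i => (hL.measurable_increments 0 p i).comap_le)
      (hL.iIndepFun_increments 0 hp.monotone)
      (Set.disjoint_left.2 fun i (h : i.castSucc < j) => not_le_of_gt h)
  have hmeas {S : Set (Fin n)} {a b : Fin (n + 1)} (hab : a ≤ b)
      (hS : ∀ i : Fin n, a ≤ i.castSucc → i.castSucc < b → i ∈ S) :
      Measurable[⨆ i ∈ S, m i] fun ω => L (p b) ω - L (p a) ω := by
    have hsum := fun ω => sum_filter_succ_sub_castSucc (fun i => L (p i) ω) hab
    simp only [← hsum]
    refine Finset.measurable_sum _ fun i hi => ?_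
    obtain ⟨-, hai, hib⟩ := Finset.mem_filter.1 hi
    have := (comap_measurable fun ω => increments L 0 p ω i).mono (le_biSup m (hS i hai hib)) le_rfl
    simpa [increments] using this
  refine indep_of_indep_of_le_left (indep_of_indep_of_le_right hindep ?_) ?_ <;>
    refine Measurable.comap_le (@measurable_pi_lambda _ _ _ (⨆ i ∈ _, m i) _ _ fun u => ?_)
  · obtain ⟨k, hk⟩ := hK (s + u) (Finset.mem_insert_of_mem (Finset.mem_union_right _
      (Finset.mem_image_of_mem (s + ↑·) u.2)))
    have hjk : j ≤ k := hp.le_iff_le.1 (hj.trans_le (le_self_add.trans_eq hk.symm))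
    simpa [incrPath, hj, hk] using hmeas hjk fun i hi _ => hi
  · obtain ⟨k, hk⟩ := hK u (Finset.mem_insert_of_mem (Finset.mem_union_left _
      (Finset.mem_image_of_mem _ u.2)))
    have hkj : k ≤ j := hp.le_iff_le.1 ((hk.trans_le u.1.2).trans_eq hj.symm)
    simpa [incrPath, hp0, hk] using hmeas (Fin.zero_le k) fun i _ hi => hi.trans_le hkj

end IsLevyProcess

end Paths

section SigmaAlgebras

variable {Ω B : Type*} [mΩ : MeasurableSpace Ω] [MeasurableSpace B] {P : Measure Ω}
  {L : ℝ≥0 → Ω → B}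

theorem measurable_sigmaPast (L : ℝ≥0 → Ω → B) (P : Measure Ω) {u t : ℝ≥0} (hu : u ≤ t) :
    Measurable[sigmaPast L P t] (L u) :=
  (comap_measurable _).mono
    (le_sup_of_le_left (le_iSup_of_le (⟨u, hu⟩ : Set.Iic t) le_rfl)) le_rfl

theorem sigmaPast_mono (L : ℝ≥0 → Ω → B) (P : Measure Ω) {s t : ℝ≥0} (h : s ≤ t) :
    sigmaPast L P s ≤ sigmaPast L P t :=
  sup_le (iSup_le fun u => (measurable_sigmaPast L P (u.2.trans h)).comap_le) le_sup_right

variable [NormedAddCommGroup B]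

/-- The σ-algebra generated by the path `u ↦ L (s + u) - L s`, `u ∈ T`. -/
abbrev pathSigma (L : ℝ≥0 → Ω → B) (s : ℝ≥0) (T : Set ℝ≥0) : MeasurableSpace Ω :=
  MeasurableSpace.pi.comap (incrPath L s T)

omit mΩ in
theorem measurable_pathSigma_apply (L : ℝ≥0 → Ω → B) (s : ℝ≥0) {T : Set ℝ≥0} {u : ℝ≥0}
    (hu : u ∈ T) : Measurable[pathSigma L s T] fun ω => L (s + u) ω - L s ω :=
  (measurable_pi_apply (⟨u, hu⟩ : T)).comp (comap_measurable (incrPath L s T))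

theorem measurable_sigmaIncr_incrPath (L : ℝ≥0 → Ω → B) (P : Measure Ω) (s t : ℝ≥0) :
    Measurable[sigmaIncr L P s (s + t)] (incrPath L s (Set.Iic t)) := by
  refine @measurable_pi_lambda _ _ _ (sigmaIncr L P s (s + t)) _ _ fun u => ?_
  refine (comap_measurable fun ω => L (s + u) ω - L s ω).mono (le_sup_of_le_left ?_) le_rfl
  exact le_iSup_of_le (⟨(s, s + u), le_rfl, le_self_add, add_le_add_right u.2 s⟩ :
    {q : ℝ≥0 × ℝ≥0 // s ≤ q.1 ∧ q.1 ≤ q.2 ∧ q.2 ≤ s + t}) le_rfl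

theorem IsLevyProcess.sigmaPast_le (hL : IsLevyProcess L P) (t : ℝ≥0) : sigmaPast L P t ≤ mΩ :=
  sup_le (iSup_le fun _ => (hL.measurable _).comap_le) nullSigma_le

theorem IsLevyProcess.comap_le_eventuallyMeasurableSpace (hL : IsLevyProcess L P)
    {T : Set ℝ≥0} {t : ℝ≥0} (ht : t ∈ T) :
    MeasurableSpace.comap (L t) inferInstance ≤
      eventuallyMeasurableSpace (pathSigma L 0 T) (ae P) := by
  refine _root_.comap_le_eventuallyMeasurableSpace (measurable_pathSigma_apply L 0 ht) ?_
  filter_upwards [hL.zero] with ω hω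
  simp [hω]

theorem IsLevyProcess.sigmaPast_le_eventuallyMeasurableSpace (hL : IsLevyProcess L P) (t : ℝ≥0) :
    sigmaPast L P t ≤ eventuallyMeasurableSpace (pathSigma L 0 (Set.Iic t)) (ae P) :=
  sup_le (iSup_le fun u => hL.comap_le_eventuallyMeasurableSpace u.2)
    nullSigma_le_eventuallyMeasurableSpace

theorem IsLevyProcess.le_eventuallyMeasurableSpace (hL : IsLevyProcess L P)
    (hgen : mΩ = sigmaAll L) :
    mΩ ≤ eventuallyMeasurableSpace (pathSigma L 0 Set.univ) (ae P) :=
  hgen.trans_le (iSup_le fun t => hL.comap_le_eventuallyMeasurableSpace (Set.mem_univ t))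

variable [BorelSpace B] [SecondCountableTopology B]

theorem sigmaIncr_le_eventuallyMeasurableSpace (L : ℝ≥0 → Ω → B) (P : Measure Ω) (s t : ℝ≥0) :
    sigmaIncr L P s (s + t) ≤ eventuallyMeasurableSpace (pathSigma L s (Set.Iic t)) (ae P) := by
  refine sup_le (iSup_le ?_) nullSigma_le_eventuallyMeasurableSpace
  rintro ⟨⟨u, v⟩, hu, huv, hv⟩
  refine le_trans (Measurable.comap_le ?_) le_eventuallyMeasurableSpace
  have hpath {w : ℝ≥0} (hw : w ≤ s + t) :=
    measurable_pathSigma_apply L s (T := Set.Iic t) (tsub_le_iff_left.2 hw)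
  simpa [add_tsub_cancel_of_le hu, add_tsub_cancel_of_le (hu.trans huv), Pi.sub_def] using
    (hpath hv).sub (hpath (huv.trans hv))

theorem measurable_sigmaPast_incrPath (L : ℝ≥0 → Ω → B) (P : Measure Ω) (s t : ℝ≥0) :
    Measurable[sigmaPast L P (s + t)] (incrPath L s (Set.Iic t)) :=
  @measurable_pi_lambda _ _ _ (sigmaPast L P (s + t)) _ _ fun u =>
    (measurable_sigmaPast L P (add_le_add_right u.2 s)).sub (measurable_sigmaPast L P le_self_add)

namespace IsLevyProcess

theorem sigmaIncr_le (hL : IsLevyProcess L P) (s t : ℝ≥0) : sigmaIncr L P s t ≤ mΩ :=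
  sup_le (iSup_le fun _ => ((hL.measurable _).sub (hL.measurable _)).comap_le) nullSigma_le

theorem exists_countable_le_eventuallyMeasurableSpace [CompleteSpace B] (hL : IsLevyProcess L P)
    (hgen : mΩ = sigmaAll L) : ∃ T : Set ℝ≥0, T.Countable ∧
      mΩ ≤ eventuallyMeasurableSpace (pathSigma L 0 T) (ae P) := by
  obtain ⟨D, hDc, hD⟩ := TopologicalSpace.exists_countable_dense ℝ≥0
  refine ⟨D, hDc, hgen.trans_le (iSup_le fun t => ?_)⟩
  obtain ⟨v, -, hv, hvt⟩ := exists_seq_strictAnti_tendsto t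
  choose q hq htq hqv using fun n => hD.exists_between (hv n)
  have hqt : Tendsto q atTop (𝓝[≥] t) := tendsto_nhdsWithin_iff.2
    ⟨tendsto_of_tendsto_of_tendsto_of_le_of_le tendsto_const_nhds hvt (fun n => (htq n).le)
      fun n => (hqv n).le, .of_forall fun n => (htq n).le⟩
  have hmeas : StronglyMeasurable[pathSigma L 0 D]
      fun ω => limUnder atTop fun n => L (0 + q n) ω - L 0 ω :=
    @StronglyMeasurable.limUnder _ _ _ (pathSigma L 0 D) _ _ _ _ _ _ _ fun n =>
      (measurable_pathSigma_apply L 0 (hq n)).stronglyMeasurable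
  refine _root_.comap_le_eventuallyMeasurableSpace hmeas.measurable ?_
  filter_upwards [hL.zero, hL.cadlag] with ω hzero hcadlag
  refine (Tendsto.limUnder_eq ?_).symm
  simpa [hzero] using! (hcadlag t).1.tendsto.comp hqt

end IsLevyProcess

end SigmaAlgebras

section Shift

section Restart

variable {Ω B : Type*} [NormedAddCommGroup B]

/-- The path `u ↦ x (b + u) - x b`, `u ∈ T`, obtained from `x` by restarting it at time `b`. -/
def restart (b : ℝ≥0) (T : Set ℝ≥0) (x : ↥(Set.univ : Set ℝ≥0) → B) : T → B :=
  fun u => x ⟨b + u, Set.mem_univ _⟩ - x ⟨b, Set.mem_univ _⟩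

theorem measurable_restart [MeasurableSpace B] [BorelSpace B] [SecondCountableTopology B]
    (b : ℝ≥0) (T : Set ℝ≥0) : Measurable (restart (B := B) b T) :=
  measurable_pi_lambda _ fun _ => (measurable_pi_apply _).sub (measurable_pi_apply _)

theorem restart_comp_incrPath (L : ℝ≥0 → Ω → B) (a b : ℝ≥0) (T : Set ℝ≥0) :
    restart b T ∘ incrPath L a Set.univ = incrPath L (a + b) T := by
  ext ω u
  simp [restart, incrPath, add_assoc]

end Restart

namespace IsLevyProcess

open scoped BoundedContinuousFunction

variable {Ω B : Type*} [mΩ : MeasurableSpace Ω] [NormedAddCommGroup B] [MeasurableSpace B]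
  [BorelSpace B] [SecondCountableTopology B] {P : Measure Ω} [IsFiniteMeasure P]
  {L : ℝ≥0 → Ω → B} (hL : IsLevyProcess L P) (hgen : mΩ = sigmaAll L)

include hgen in
theorem surjective_pullbackL2_incrPath :
    Function.Surjective (pullbackL2 (hL.measurePreserving_incrPath 0 Set.univ)) := fun f =>
  L2Sub_le_range_pullbackL2 (hL.measurePreserving_incrPath 0 Set.univ) le_rfl
    (hL.le_eventuallyMeasurableSpace hgen) (mem_lpMeas_self P f)

include hL hgen in
theorem exists_measurable_comp (f : Lp ℂ 2 P) :
    ∃ h : (↥(Set.univ : Set ℝ≥0) → B) → ℂ, Measurable h ∧ f =ᵐ[P] h ∘ incrPath L 0 Set.univ :=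
  exists_measurable_comp_of_mem_L2Sub (hL.measurable_incrPath 0 Set.univ) le_rfl
    (hL.le_eventuallyMeasurableSpace hgen) (mem_lpMeas_self P f)

/-- The isometry of `L²(Ω, P)` which sends `h(L_u - L_0 : u ≥ 0)` to `h(L_{s+u} - L_s : u ≥ 0)`. -/
noncomputable def shift (s : ℝ≥0) : Lp ℂ 2 P →ₗᵢ[ℂ] Lp ℂ 2 P :=
  (pullbackL2 (hL.measurePreserving_incrPath s Set.univ)).comp
    (LinearIsometryEquiv.ofSurjective (pullbackL2 (hL.measurePreserving_incrPath 0 Set.univ))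
      (hL.surjective_pullbackL2_incrPath hgen)).symm.toLinearIsometry

theorem shift_pullbackL2 (s : ℝ≥0) (g : Lp ℂ 2 (P.map (incrPath L 0 Set.univ))) :
    hL.shift hgen s (pullbackL2 (hL.measurePreserving_incrPath 0 Set.univ) g) =
      pullbackL2 (hL.measurePreserving_incrPath s Set.univ) g :=
  congrArg (pullbackL2 (hL.measurePreserving_incrPath s Set.univ)) <|
    (LinearIsometryEquiv.ofSurjective (pullbackL2 (hL.measurePreserving_incrPath 0 Set.univ))
      (hL.surjective_pullbackL2_incrPath hgen)).symm_apply_apply g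

theorem shift_ae_eq (a : ℝ≥0) {b : ℝ≥0} {T : Set ℝ≥0} {h : (T → B) → ℂ} (hh : Measurable h)
    {f : Lp ℂ 2 P} (hf : f =ᵐ[P] h ∘ incrPath L b T) :
    hL.shift hgen a f =ᵐ[P] h ∘ incrPath L (a + b) T := by
  obtain ⟨g, rfl⟩ := hL.surjective_pullbackL2_incrPath hgen f
  have hg : g =ᵐ[P.map (incrPath L 0 Set.univ)] h ∘ restart b T := by
    refine (ae_map_iff (hL.measurable_incrPath 0 Set.univ).aemeasurable (measurableSet_eq_fun
      (Lp.stronglyMeasurable g).measurable (hh.comp (measurable_restart b T)))).2 ?_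
    refine ((pullbackL2_coeFn _ g).symm.trans hf).trans (.of_eq ?_)
    rw [← zero_add b, ← restart_comp_incrPath, zero_add]
    rfl
  rw [shift_pullbackL2, ← restart_comp_incrPath, ← Function.comp_assoc]
  exact (pullbackL2_coeFn _ g).trans
    ((hL.measurePreserving_incrPath a Set.univ).quasiMeasurePreserving.ae_eq_comp hg)

theorem shift_zero : hL.shift hgen 0 = LinearIsometry.id := by
  ext1 f
  obtain ⟨h, hh, hf⟩ := hL.exists_measurable_comp hgen f
  refine Lp.ext (EventuallyEq.trans ?_ hf.symm)
  simpa using hL.shift_ae_eq hgen 0 hh hf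

theorem shift_shift (a b : ℝ≥0) (f : Lp ℂ 2 P) :
    hL.shift hgen a (hL.shift hgen b f) = hL.shift hgen (a + b) f := by
  obtain ⟨h, hh, hf⟩ := hL.exists_measurable_comp hgen f
  refine Lp.ext ((hL.shift_ae_eq hgen a hh (hL.shift_ae_eq hgen b hh hf)).trans ?_)
  simpa only [add_assoc] using (hL.shift_ae_eq hgen (a + b) hh hf).symm

theorem shift_mul (a : ℝ≥0) {f g k : Lp ℂ 2 P} (hk : k =ᵐ[P] f * g) :
    hL.shift hgen a k =ᵐ[P] hL.shift hgen a f * hL.shift hgen a g := by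
  obtain ⟨φ, hφ, hf⟩ := hL.exists_measurable_comp hgen f
  obtain ⟨ψ, hψ, hg⟩ := hL.exists_measurable_comp hgen g
  exact (hL.shift_ae_eq hgen a (hφ.mul hψ) (hk.trans (hf.mul hg))).trans
    ((hL.shift_ae_eq hgen a hφ hf).mul (hL.shift_ae_eq hgen a hψ hg)).symm

theorem shift_mem (s t : ℝ≥0) {f : Lp ℂ 2 P} (hf : f ∈ L2Sub P (sigmaPast L P t)) :
    hL.shift hgen s f ∈ L2Sub P (sigmaIncr L P s (s + t)) := by
  obtain ⟨h, hh, hfh⟩ := exists_measurable_comp_of_mem_L2Sub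
    (hL.measurable_incrPath 0 (Set.Iic t)) (hL.sigmaPast_le t)
    (hL.sigmaPast_le_eventuallyMeasurableSpace t) hf
  refine mem_L2Sub_of_ae_eq (hh.comp (measurable_sigmaIncr_incrPath L P s t)) ?_
  simpa using hL.shift_ae_eq hgen s hh hfh

theorem exists_shift_eq (s t : ℝ≥0) {f : Lp ℂ 2 P} (hf : f ∈ L2Sub P (sigmaIncr L P s (s + t))) :
    ∃ g ∈ L2Sub P (sigmaPast L P t), hL.shift hgen s g = f := by
  obtain ⟨k, rfl⟩ := L2Sub_le_range_pullbackL2 (hL.measurePreserving_incrPath s (Set.Iic t))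
    (hL.sigmaIncr_le _ _) (sigmaIncr_le_eventuallyMeasurableSpace L P s t) hf
  have hk := (Lp.stronglyMeasurable k).measurable
  have hg := pullbackL2_coeFn (hL.measurePreserving_incrPath 0 (Set.Iic t)) k
  have hmeas := measurable_sigmaPast_incrPath L P 0 t
  rw [zero_add] at hmeas
  refine ⟨_, mem_L2Sub_of_ae_eq (hk.comp hmeas) hg, Lp.ext ?_⟩
  refine (hL.shift_ae_eq hgen s hk hg).trans ?_
  simpa only [add_zero] using!
    (pullbackL2_coeFn (hL.measurePreserving_incrPath s (Set.Iic t)) k).symm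

/-- The unitaries `S_{s,t} : L²(F_t) → L²(F_{s,s+t})` which restrict the shift. -/
noncomputable def shiftFamily : ShiftFamily L P := fun s t =>
  LinearIsometryEquiv.ofSurjective
    (⟨(hL.shift hgen s).toLinearMap.restrict fun _ => hL.shift_mem hgen s t,
      fun f => (hL.shift hgen s).norm_map f⟩ :
      L2Sub P (sigmaPast L P t) →ₗᵢ[ℂ] L2Sub P (sigmaIncr L P s (s + t)))
    fun f =>
      let ⟨g, hg, hgf⟩ := hL.exists_shift_eq hgen s t f.2
      ⟨⟨g, hg⟩, Subtype.ext hgf⟩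

@[simp]
theorem shiftFamily_coe (s t : ℝ≥0) (f : L2Sub P (sigmaPast L P t)) :
    (hL.shiftFamily hgen s t f : Lp ℂ 2 P) = hL.shift hgen s f := rfl

theorem isShiftFamily_shiftFamily : IsShiftFamily L P (hL.shiftFamily hgen) := by
  intro s t n p hp _ hpt τ hτ _ f hf
  have hpt' (i : Fin (n + 1)) : p i ≤ t := (hp i.le_last).trans_eq hpt
  let ψ (x : Set.Iic t → B) (i : Fin n) : B :=
    x ⟨p i.succ, hpt' i.succ⟩ - x ⟨p i.castSucc, hpt' i.castSucc⟩
  have hψ : Measurable ψ :=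
    measurable_pi_lambda _ fun i => (measurable_pi_apply _).sub (measurable_pi_apply _)
  have hincr (r : ℝ≥0) : increments L r p = ψ ∘ incrPath L r (Set.Iic t) := by
    ext ω i
    simp [ψ, increments, incrPath]
  rw [hincr] at hf ⊢
  simpa using! hL.shift_ae_eq hgen s (hτ.comp hψ) hf

include hL in
theorem eq_of_isShiftFamily {S S' : ShiftFamily L P} (hS : IsShiftFamily L P S)
    (hS' : IsShiftFamily L P S') : S' = S := by
  ext s t : 2
  let V := (LinearMap.eqLocus (S' s t).toLinearMap (S s t).toLinearMap).map
    (L2Sub P (sigmaPast L P t)).subtype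
  have hV : IsClosed (V : Set (Lp ℂ 2 P)) :=
    (isClosed_L2Sub (hL.sigmaPast_le t)).isClosedEmbedding_subtypeVal.isClosedMap _
      (isClosed_eq (S' s t).continuous (S s t).continuous)
  have hpath := measurable_sigmaPast_incrPath L P 0 t
  rw [zero_add] at hpath
  suffices L2Sub P (sigmaPast L P t) ≤ V by
    ext1 f
    obtain ⟨g, hg, hgf⟩ := this f.2
    exact Subtype.ext hgf ▸ hg
  refine L2Sub_le_of_boundedContinuous (hL.measurable_incrPath 0 (Set.Iic t)) (hL.sigmaPast_le t)
    (hL.sigmaPast_le_eventuallyMeasurableSpace t) hV fun I φ => ?_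
  obtain ⟨n, p, hp, hp0, hpt, ψ, hψ, h⟩ := exists_restrict_incrPath_eq_increments (Ω := Ω) (B := B)
    I fun u _ => u.2
  have hf := MemLp.coeFn_toLp (memLp_boundedContinuous_comp (P := P) φ
    ((Finset.measurable_restrict I).comp (hL.measurable_incrPath 0 (Set.Iic t))) 2)
  have hfmem := mem_L2Sub_of_ae_eq
    (φ.continuous.measurable.comp ((Finset.measurable_restrict I).comp hpath)) hf
  have hfψ := hf.trans (.of_forall fun ω => congrArg φ (h L 0 ω))
  have hτ : Measurable (φ ∘ ψ) := φ.continuous.measurable.comp hψ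
  have hbdd : ∃ C : ℝ, ∀ x, ‖(φ ∘ ψ) x‖ ≤ C := ⟨‖φ‖, fun x => φ.norm_coe_le_norm (ψ x)⟩
  exact ⟨⟨_, hfmem⟩, Subtype.ext <| Lp.ext <|
    (hS' s t n p hp hp0 hpt (φ ∘ ψ) hτ hbdd _ hfψ).trans
      (hS s t n p hp hp0 hpt (φ ∘ ψ) hτ hbdd _ hfψ).symm, rfl⟩

theorem shift_eq_pullbackL2 (s : ℝ≥0) {σ : Ω → Ω} (hσ : MeasurePreserving σ P P)
    (hLσ : ∀ t, ∀ᵐ ω ∂P, L t (σ ω) = L (s + t) ω - L s ω) (g : Lp ℂ 2 P) :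
    hL.shift hgen s g = pullbackL2 hσ g := by
  let V := LinearMap.eqLocus (hL.shift hgen s).toLinearMap (pullbackL2 hσ).toLinearMap
  have hV : IsClosed (V : Set (Lp ℂ 2 P)) :=
    isClosed_eq (hL.shift hgen s).continuous (pullbackL2 hσ).continuous
  have hX := hL.measurable_incrPath 0 Set.univ
  refine L2Sub_le_of_boundedContinuous (V := V) hX le_rfl
    (hL.le_eventuallyMeasurableSpace hgen) hV (fun I φ => Lp.ext ?_) (mem_lpMeas_self P g)
  have hφ : Measurable fun x : ↥(Set.univ : Set ℝ≥0) → B => φ (I.restrict x) :=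
    φ.continuous.measurable.comp (Finset.measurable_restrict I)
  have hf := MemLp.coeFn_toLp
    (memLp_boundedContinuous_comp (P := P) φ ((Finset.measurable_restrict I).comp hX) 2)
  refine (hL.shift_ae_eq hgen s hφ hf).trans (EventuallyEq.trans ?_ ((pullbackL2_coeFn hσ _).trans
    (hσ.quasiMeasurePreserving.ae_eq_comp hf)).symm)
  filter_upwards [hLσ 0, ae_all_iff.2 fun u : I => hLσ u] with ω h0 hI
  refine congrArg φ (funext fun u => ?_)
  simp [incrPath, h0, hI]

end IsLevyProcess

end Shift

section StrongContinuity

theorem isClosed_setOf_tendsto_apply_self {ι X : Type*} [PseudoMetricSpace X] {T : ι → X → X}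
    (hT : ∀ i, LipschitzWith 1 (T i)) (l : Filter ι) :
    IsClosed {x | Tendsto (fun i => T i x) l (𝓝 x)} := by
  refine isClosed_of_closure_subset fun x hx => Metric.tendsto_nhds.2 fun ε hε => ?_
  obtain ⟨y, hy, hxy⟩ := Metric.mem_closure_iff.1 hx (ε / 3) (by positivity)
  filter_upwards [Metric.tendsto_nhds.1 hy (ε / 3) (by positivity)] with i hi
  have hle := (hT i).dist_le_mul x y
  rw [NNReal.coe_one, one_mul] at hle
  linarith [dist_triangle4 (T i x) (T i y) y x, dist_comm x y]

theorem continuous_of_dist_add_eq {X : Type*} [PseudoMetricSpace X] {f : ℝ≥0 → X}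
    (hf : ∀ a b, dist (f (a + b)) (f a) = dist (f b) (f 0)) (h0 : ContinuousAt f 0) :
    Continuous f := by
  have hdist (a b : ℝ≥0) : dist (f b) (f a) = dist (f (nndist b a)) (f 0) := by
    wlog h : a ≤ b generalizing a b
    · rw [dist_comm, this b a (le_of_not_ge h), nndist_comm]
    · rw [← hf a, NNReal.nndist_eq, tsub_eq_zero_of_le h, max_eq_left zero_le,
        add_tsub_cancel_of_le h]
  refine continuous_iff_continuousAt.2 fun a => tendsto_iff_dist_tendsto_zero.2 ?_
  have hnndist : Tendsto (fun b => nndist b a) (𝓝 a) (𝓝 0) := by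
    have hcont : Continuous fun b : ℝ≥0 => nndist b a := by fun_prop
    simpa only [nndist_self] using hcont.tendsto a
  exact ((tendsto_iff_dist_tendsto_zero.1 h0).comp hnndist).congr fun b => (hdist a b).symm

namespace IsLevyProcess

open scoped BoundedContinuousFunction

theorem ae_tendsto_incrPath {Ω B : Type*} [MeasurableSpace Ω] [NormedAddCommGroup B]
    [MeasurableSpace B] {P : Measure Ω} {L : ℝ≥0 → Ω → B} (hL : IsLevyProcess L P) (T : Set ℝ≥0) :
    ∀ᵐ ω ∂P, Tendsto (fun r => incrPath L r T ω) (𝓝 0) (𝓝 (incrPath L 0 T ω)) := by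
  filter_upwards [hL.cadlag] with ω hω
  have hright (v : ℝ≥0) : Tendsto (fun r => L (r + v) ω) (𝓝 0) (𝓝 (L (0 + v) ω)) := by
    rw [zero_add]
    refine (hω v).1.tendsto.comp
      (tendsto_nhdsWithin_iff.2 ⟨?_, .of_forall fun r => Set.mem_Ici.2 le_add_self⟩)
    simpa using (continuous_add_const v).tendsto 0
  refine tendsto_pi_nhds.2 fun u => (hright u).sub ?_
  simpa using hright 0

variable {Ω B : Type*} [mΩ : MeasurableSpace Ω] [NormedAddCommGroup B] [MeasurableSpace B]
  [BorelSpace B] [SecondCountableTopology B] {P : Measure Ω} [IsFiniteMeasure P]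
  {L : ℝ≥0 → Ω → B}

theorem separableSpace_L2 [CompleteSpace B] (hL : IsLevyProcess L P) (hgen : mΩ = sigmaAll L) :
    TopologicalSpace.SeparableSpace (Lp ℂ 2 P) := by
  obtain ⟨T, hT, hle⟩ := hL.exists_countable_le_eventuallyMeasurableSpace hgen
  have := hT.to_subtype
  have : Fact ((2 : ℝ≥0∞) ≠ ∞) := ⟨ENNReal.ofNat_ne_top⟩
  have hX := hL.measurePreserving_incrPath 0 T
  have hsurj : Function.Surjective (pullbackL2 hX) := fun f =>
    L2Sub_le_range_pullbackL2 hX le_rfl hle (mem_lpMeas_self P f)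
  exact hsurj.denseRange.separableSpace (pullbackL2 hX).continuous

variable (hL : IsLevyProcess L P) (hgen : mΩ = sigmaAll L)

theorem tendsto_shift (f : Lp ℂ 2 P) : Tendsto (fun r => hL.shift hgen r f) (𝓝 0) (𝓝 f) := by
  let V : Submodule ℂ (Lp ℂ 2 P) :=
    { carrier := {f | Tendsto (fun r => hL.shift hgen r f) (𝓝 0) (𝓝 f)}
      zero_mem' := by simp
      add_mem' := fun hf hg => by simpa using Tendsto.add hf hg
      smul_mem' := fun c f hf => by simpa using Tendsto.const_smul hf c }
  have hV : IsClosed (V : Set (Lp ℂ 2 P)) :=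
    isClosed_setOf_tendsto_apply_self (fun r => (hL.shift hgen r).lipschitz) (𝓝 0)
  have hX (r : ℝ≥0) := hL.measurable_incrPath r Set.univ
  refine L2Sub_le_of_boundedContinuous (V := V) (hX 0) le_rfl
    (hL.le_eventuallyMeasurableSpace hgen) hV (fun I φ => ?_) (mem_lpMeas_self P f)
  have hI (r : ℝ≥0) := (Finset.measurable_restrict I).comp (hX r)
  have hφ : Measurable fun x : ↥(Set.univ : Set ℝ≥0) → B => φ (I.restrict x) :=
    φ.continuous.measurable.comp (Finset.measurable_restrict I)
  have hshift (r : ℝ≥0) :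
      hL.shift hgen r ((memLp_boundedContinuous_comp φ (hI 0) 2).toLp _) =
        (memLp_boundedContinuous_comp φ (hI r) 2).toLp _ := by
    refine Lp.ext ((hL.shift_ae_eq hgen r hφ (MemLp.coeFn_toLp _)).trans ?_)
    rw [add_zero]
    exact (MemLp.coeFn_toLp _).symm
  change Tendsto _ _ _
  simp_rw [hshift]
  refine tendsto_toLp_boundedContinuous_comp φ hI (hI 0) ?_
  filter_upwards [hL.ae_tendsto_incrPath Set.univ] with ω hω
  exact ((Finset.continuous_restrict I).tendsto _).comp hω

theorem continuous_shift : Continuous fun q : ℝ≥0 × Lp ℂ 2 P => hL.shift hgen q.1 q.2 := by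
  refine continuous_prod_of_continuous_lipschitzWith' _ 1
    (fun a => (hL.shift hgen a).lipschitz) fun f => continuous_of_dist_add_eq (fun a b => ?_) ?_
  · rw [← shift_shift, (hL.shift hgen a).dist_map, shift_zero, LinearIsometry.id_apply]
  · simpa [ContinuousAt, shift_zero] using! hL.tendsto_shift hgen f

end IsLevyProcess

end StrongContinuity

section Extension

variable {𝕜 H K M : Type*} [RCLike 𝕜] [NormedAddCommGroup H] [InnerProductSpace 𝕜 H]
  [NormedAddCommGroup K] [InnerProductSpace 𝕜 K] [NormedAddCommGroup M] [InnerProductSpace 𝕜 M]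

theorem inner_lift_lift {b : H →ₗ[𝕜] K →ₗ[𝕜] M}
    (hb : ∀ x x' y y', inner 𝕜 (b x y) (b x' y') = inner 𝕜 x x' * inner 𝕜 y y')
    (z w : H ⊗[𝕜] K) :
    inner 𝕜 (TensorProduct.lift b z) (TensorProduct.lift b w) = inner 𝕜 z w := by
  induction z using TensorProduct.induction_on with
  | zero => simp
  | add z z' hz hz' => rw [map_add, inner_add_left, inner_add_left, hz, hz']
  | tmul x y =>
    induction w using TensorProduct.induction_on with
    | zero => simp
    | add w w' hw hw' => rw [map_add, inner_add_right, inner_add_right, hw, hw']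
    | tmul x' y' => rw [TensorProduct.lift.tmul, TensorProduct.lift.tmul, hb,
        TensorProduct.inner_tmul]

theorem exists_linearIsometry_completion [CompleteSpace M] (f : H →ₗᵢ[𝕜] M) :
    ∃ F : UniformSpace.Completion H →ₗᵢ[𝕜] M, ∀ z : H, F z = f z := by
  have hext (z : H) :
      f.toContinuousLinearMap.extend (UniformSpace.Completion.toComplL (𝕜 := 𝕜)) z = f z :=
    ContinuousLinearMap.extend_eq _ UniformSpace.Completion.denseRange_coe
      (UniformSpace.Completion.isUniformInducing_coe _) z
  set F := f.toContinuousLinearMap.extend (UniformSpace.Completion.toComplL (𝕜 := 𝕜))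
  refine ⟨⟨F.toLinearMap, fun z => ?_⟩, hext⟩
  induction z using UniformSpace.Completion.induction_on with
  | hp => exact isClosed_eq F.continuous.norm continuous_norm
  | ih z =>
    rw [UniformSpace.Completion.norm_coe, ← f.norm_map, ← hext]
    rfl

end Extension

section HilbertTensor

variable {H K M : Type*} [NormedAddCommGroup H] [InnerProductSpace ℂ H]
  [NormedAddCommGroup K] [InnerProductSpace ℂ K] [NormedAddCommGroup M] [InnerProductSpace ℂ M]

theorem exists_hilbertTensor_equiv [CompleteSpace M] (b : H →ₗ[ℂ] K →ₗ[ℂ] M)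
    (hb : ∀ x x' y y', inner ℂ (b x y) (b x' y') = inner ℂ x x' * inner ℂ y y')
    (hd : ∀ V : Submodule ℂ M, IsClosed (V : Set M) → (∀ x y, b x y ∈ V) → V = ⊤) :
    ∃ U : HilbertTensor H K ≃ₗᵢ[ℂ] M, ∀ x y, U (pureTensor x y) = b x y := by
  obtain ⟨F, hF⟩ := exists_linearIsometry_completion
    ((TensorProduct.lift b).isometryOfInner (inner_lift_lift hb))
  have hpure (x : H) (y : K) : F (pureTensor x y) = b x y :=
    (hF _).trans (TensorProduct.lift.tmul x y)
  have hsurj : Function.Surjective F := LinearMap.range_eq_top.1 <|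
    hd _ F.isometry.isClosedEmbedding.isClosed_range fun x y => ⟨_, hpure x y⟩
  exact ⟨LinearIsometryEquiv.ofSurjective F hsurj, hpure⟩

theorem hilbertTensor_equiv_ext {U U' : HilbertTensor H K ≃ₗᵢ[ℂ] M}
    (h : ∀ x y, U (pureTensor x y) = U' (pureTensor x y)) : U = U' := by
  refine LinearIsometryEquiv.ext fun z => ?_
  induction z using UniformSpace.Completion.induction_on with
  | hp => exact isClosed_eq U.continuous U'.continuous
  | ih z =>
    induction z using TensorProduct.induction_on with
    | zero => rw [UniformSpace.Completion.coe_zero, map_zero, map_zero]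
    | add z w hz hw => rw [UniformSpace.Completion.coe_add, map_add, map_add, hz, hw]
    | tmul x y => exact h x y

end HilbertTensor

section Independence

variable {Ω : Type*} [MeasurableSpace Ω] {P : Measure Ω}

theorem memLp_two_mul_of_indepFun {f g : Ω → ℂ} (h : IndepFun f g P) (hf : MemLp f 2 P)
    (hg : MemLp g 2 P) : MemLp (f * g) 2 P := by
  rw [memLp_two_iff_integrable_sq_norm (hf.1.mul hg.1)]
  have hsq : Measurable fun z : ℂ => ‖z‖ ^ 2 := by fun_prop
  refine ((h.comp hsq hsq).integrable_mul ((memLp_two_iff_integrable_sq_norm hf.1).1 hf)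
    ((memLp_two_iff_integrable_sq_norm hg.1).1 hg)).congr (.of_forall fun ω => ?_)
  simp [mul_pow]

theorem integral_inner_mul_of_indepFun {f f' g g' : Ω → ℂ}
    (h : IndepFun (fun ω => (f ω, f' ω)) (fun ω => (g ω, g' ω)) P)
    (hf : AEStronglyMeasurable f P) (hf' : AEStronglyMeasurable f' P)
    (hg : AEStronglyMeasurable g P) (hg' : AEStronglyMeasurable g' P) :
    ∫ ω, inner ℂ (f ω * g ω) (f' ω * g' ω) ∂P =
      (∫ ω, inner ℂ (f ω) (f' ω) ∂P) * ∫ ω, inner ℂ (g ω) (g' ω) ∂P := by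
  have hinner : Measurable fun z : ℂ × ℂ => (inner ℂ z.1 z.2 : ℂ) := by fun_prop
  refine (integral_congr_ae (.of_forall fun ω => ?_)).trans
    ((h.comp hinner hinner).integral_fun_mul_eq_mul_integral (hf.inner hf') (hg.inner hg'))
  simp only [Function.comp_apply, RCLike.inner_apply, map_mul]
  ring

end Independence

section Multiplication

namespace IsLevyProcess

variable {Ω B : Type*} [mΩ : MeasurableSpace Ω] [NormedAddCommGroup B] [MeasurableSpace B]
  [BorelSpace B] [SecondCountableTopology B] {P : Measure Ω} {L : ℝ≥0 → Ω → B}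

theorem sigmaPast_add_le (hL : IsLevyProcess L P) (s t : ℝ≥0) :
    sigmaPast L P (s + t) ≤ eventuallyMeasurableSpace
      (MeasurableSpace.comap (fun ω => (incrPath L 0 (Set.Iic s) ω, incrPath L s (Set.Iic t) ω))
        inferInstance) (ae P) := by
  have hzero := hL.zero
  let m : MeasurableSpace Ω := MeasurableSpace.comap
    (fun ω => (incrPath L 0 (Set.Iic s) ω, incrPath L s (Set.Iic t) ω)) inferInstance
  have hpast : ∀ u : Set.Iic s, Measurable[m] fun ω => incrPath L 0 (Set.Iic s) ω u :=
    measurable_pi_iff.1 (measurable_fst.comp (comap_measurable _))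
  have hincr : ∀ u : Set.Iic t, Measurable[m] fun ω => incrPath L s (Set.Iic t) ω u :=
    measurable_pi_iff.1 (measurable_snd.comp (comap_measurable _))
  refine sup_le (iSup_le fun ⟨u, hu⟩ => ?_) nullSigma_le_eventuallyMeasurableSpace
  rcases le_total u s with hus | hsu
  · refine _root_.comap_le_eventuallyMeasurableSpace (hpast ⟨u, hus⟩) ?_
    filter_upwards [hzero] with ω hω
    simp [incrPath, hω]
  · refine _root_.comap_le_eventuallyMeasurableSpace
      ((hpast ⟨s, Set.mem_Iic.2 le_rfl⟩).add
        (hincr ⟨u - s, Set.mem_Iic.2 (tsub_le_iff_left.2 hu)⟩)) ?_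
    filter_upwards [hzero] with ω hω
    simp [incrPath, hω, add_tsub_cancel_of_le hsu]

variable [IsProbabilityMeasure P] (hL : IsLevyProcess L P) (hgen : mΩ = sigmaAll L)

theorem indepFun_prodMk_shift {s : ℝ≥0} {f f' : Lp ℂ 2 P} (hf : f ∈ L2Sub P (sigmaPast L P s))
    (hf' : f' ∈ L2Sub P (sigmaPast L P s)) (g g' : Lp ℂ 2 P) :
    IndepFun (fun ω => (f ω, f' ω)) (fun ω => (hL.shift hgen s g ω, hL.shift hgen s g' ω)) P := by
  have hX := hL.measurable_incrPath 0 (Set.Iic s)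
  have hle := hL.sigmaPast_le_eventuallyMeasurableSpace s
  obtain ⟨φ, hφ, hfφ⟩ := exists_measurable_comp_of_mem_L2Sub hX (hL.sigmaPast_le s) hle hf
  obtain ⟨φ', hφ', hfφ'⟩ := exists_measurable_comp_of_mem_L2Sub hX (hL.sigmaPast_le s) hle hf'
  obtain ⟨ψ, hψ, hgψ⟩ := hL.exists_measurable_comp hgen g
  obtain ⟨ψ', hψ', hgψ'⟩ := hL.exists_measurable_comp hgen g'
  have hshift := (hL.shift_ae_eq hgen s hψ hgψ).prodMk (hL.shift_ae_eq hgen s hψ' hgψ')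
  rw [add_zero] at hshift
  exact ((hL.indepFun_incrPath s Set.univ).comp (hφ.prodMk hφ') (hψ.prodMk hψ')).congr
    (hfφ.prodMk hfφ').symm hshift.symm

theorem memLp_mul_shift {s : ℝ≥0} (f : L2Sub P (sigmaPast L P s)) (g : Lp ℂ 2 P) :
    MemLp (⇑(f : Lp ℂ 2 P) * ⇑(hL.shift hgen s g)) 2 P :=
  memLp_two_mul_of_indepFun
    ((hL.indepFun_prodMk_shift hgen f.2 f.2 g g).comp measurable_fst measurable_fst)
    (Lp.memLp _) (Lp.memLp _)

/-- The multiplication `(f, g) ↦ f · S_s g`. The factor `g` ranges over all of `L²(Ω, P)`. -/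
noncomputable def mulShift (s : ℝ≥0) :
    L2Sub P (sigmaPast L P s) →ₗ[ℂ] Lp ℂ 2 P →ₗ[ℂ] Lp ℂ 2 P :=
  LinearMap.mk₂ ℂ (fun f g => (hL.memLp_mul_shift hgen f g).toLp)
    (fun f f' g => by
      rw [← MemLp.toLp_add, MemLp.toLp_eq_toLp_iff, ← add_mul]
      exact (Lp.coeFn_add _ _).mul .rfl)
    (fun c f g => by
      rw [← MemLp.toLp_const_smul, MemLp.toLp_eq_toLp_iff, ← smul_mul_assoc]
      exact (Lp.coeFn_smul _ _).mul .rfl)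
    (fun f g g' => by
      rw [← MemLp.toLp_add, MemLp.toLp_eq_toLp_iff, ← mul_add, map_add]
      exact .mul .rfl (Lp.coeFn_add _ _))
    (fun c f g => by
      rw [← MemLp.toLp_const_smul, MemLp.toLp_eq_toLp_iff, ← mul_smul_comm, map_smul]
      exact .mul .rfl (Lp.coeFn_smul _ _))

theorem mulShift_ae_eq {s : ℝ≥0} (f : L2Sub P (sigmaPast L P s)) (g : Lp ℂ 2 P) :
    hL.mulShift hgen s f g =ᵐ[P] ⇑(f : Lp ℂ 2 P) * ⇑(hL.shift hgen s g) :=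
  (hL.memLp_mul_shift hgen f g).coeFn_toLp

theorem inner_mulShift {s : ℝ≥0} (f f' : L2Sub P (sigmaPast L P s)) (g g' : Lp ℂ 2 P) :
    inner ℂ (hL.mulShift hgen s f g) (hL.mulShift hgen s f' g') = inner ℂ f f' * inner ℂ g g' := by
  rw [← (hL.shift hgen s).inner_map_map g g', Submodule.coe_inner, L2.inner_def, L2.inner_def,
    L2.inner_def, ← integral_inner_mul_of_indepFun (hL.indepFun_prodMk_shift hgen f.2 f'.2 g g')
      (Lp.aestronglyMeasurable _) (Lp.aestronglyMeasurable _) (Lp.aestronglyMeasurable _)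
      (Lp.aestronglyMeasurable _)]
  refine integral_congr_ae ?_
  filter_upwards [hL.mulShift_ae_eq hgen f g, hL.mulShift_ae_eq hgen f' g'] with ω h h'
  rw [h, h', Pi.mul_apply, Pi.mul_apply]

theorem norm_mulShift {s : ℝ≥0} (f : L2Sub P (sigmaPast L P s)) (g : Lp ℂ 2 P) :
    ‖hL.mulShift hgen s f g‖ = ‖f‖ * ‖g‖ := by
  have h := hL.inner_mulShift hgen f f g g
  rw [inner_self_eq_norm_sq_to_K, inner_self_eq_norm_sq_to_K (𝕜 := ℂ) f,
    inner_self_eq_norm_sq_to_K, ← mul_pow] at h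
  exact (pow_left_inj₀ (by positivity) (by positivity) two_ne_zero).1 (by exact_mod_cast h)

theorem inner_indicatorL2_mulShift {A : Set Ω} (hA : MeasurableSet A) {s : ℝ≥0}
    (f : L2Sub P (sigmaPast L P s)) (g : Lp ℂ 2 P) :
    inner ℂ (indicatorL2 P hA) (hL.mulShift hgen s f g) =
      ∫ ω in A, (f : Lp ℂ 2 P) ω * hL.shift hgen s g ω ∂P := by
  rw [L2.inner_indicatorConstLp_one]
  exact integral_congr_ae (ae_restrict_of_ae (hL.mulShift_ae_eq hgen f g))

theorem shift_mem_sigmaPast (s t : ℝ≥0) {f : Lp ℂ 2 P} (hf : f ∈ L2Sub P (sigmaPast L P t)) :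
    hL.shift hgen s f ∈ L2Sub P (sigmaPast L P (s + t)) := by
  obtain ⟨h, hh, hfh⟩ := exists_measurable_comp_of_mem_L2Sub
    (hL.measurable_incrPath 0 (Set.Iic t)) (hL.sigmaPast_le t)
    (hL.sigmaPast_le_eventuallyMeasurableSpace t) hf
  refine mem_L2Sub_of_ae_eq (hh.comp (measurable_sigmaPast_incrPath L P s t)) ?_
  simpa using hL.shift_ae_eq hgen s hh hfh

theorem mulShift_mem {s t : ℝ≥0} (f : L2Sub P (sigmaPast L P s))
    (g : L2Sub P (sigmaPast L P t)) :
    hL.mulShift hgen s f g ∈ L2Sub P (sigmaPast L P (s + t)) := by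
  refine mem_lpMeas_iff_aestronglyMeasurable.2 (AEStronglyMeasurable.congr ?_
    (hL.mulShift_ae_eq hgen f g).symm)
  exact ((mem_lpMeas_iff_aestronglyMeasurable.1 f.2).mono
    (sigmaPast_mono L P le_self_add)).mul
    (mem_lpMeas_iff_aestronglyMeasurable.1 (hL.shift_mem_sigmaPast hgen s t g.2))

/-- The multiplication `(f, g) ↦ f · S_s g` as a map `L²(F_s) × L²(F_t) → L²(F_{s+t})`. -/
noncomputable def mulFibre (s t : ℝ≥0) : L2Sub P (sigmaPast L P s) →ₗ[ℂ]
    L2Sub P (sigmaPast L P t) →ₗ[ℂ] L2Sub P (sigmaPast L P (s + t)) :=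
  LinearMap.mk₂ ℂ (fun f g => ⟨hL.mulShift hgen s f g, hL.mulShift_mem hgen f g⟩)
    (fun f f' g => Subtype.ext (by simp))
    (fun c f g => Subtype.ext (by simp))
    (fun f g g' => Subtype.ext (by simp))
    (fun c f g => Subtype.ext (by simp))

@[simp]
theorem mulFibre_coe {s t : ℝ≥0} (f : L2Sub P (sigmaPast L P s)) (g : L2Sub P (sigmaPast L P t)) :
    (hL.mulFibre hgen s t f g : Lp ℂ 2 P) = hL.mulShift hgen s f g := rfl

theorem mulShift_indicatorL2 {s t : ℝ≥0} {C : Set (Set.Iic s → B)} {D : Set (Set.Iic t → B)}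
    (hC : MeasurableSet C) (hD : MeasurableSet D)
    (hCs : indicatorL2 P (hL.measurable_incrPath 0 (Set.Iic s) hC) ∈ L2Sub P (sigmaPast L P s)) :
    hL.mulShift hgen s ⟨_, hCs⟩ (indicatorL2 P (hL.measurable_incrPath 0 (Set.Iic t) hD)) =
      indicatorL2 P (((hL.measurable_incrPath 0 (Set.Iic s)).prodMk
        (hL.measurable_incrPath s (Set.Iic t))) (hC.prod hD)) := by
  have hshift := hL.shift_ae_eq hgen s (measurable_const.indicator (f := fun _ => (1 : ℂ)) hD)
    (f := indicatorL2 P (hL.measurable_incrPath 0 (Set.Iic t) hD)) indicatorConstLp_coeFn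
  rw [add_zero] at hshift
  have hprod : ((incrPath L 0 (Set.Iic s) ⁻¹' C).indicator fun _ => (1 : ℂ)) *
      (D.indicator fun _ => 1) ∘ incrPath L s (Set.Iic t) =
      ((fun ω => (incrPath L 0 (Set.Iic s) ω, incrPath L s (Set.Iic t) ω)) ⁻¹' C ×ˢ D).indicator
        fun _ => 1 := by
    ext ω
    by_cases hωC : incrPath L 0 (Set.Iic s) ω ∈ C <;>
      by_cases hωD : incrPath L s (Set.Iic t) ω ∈ D <;> simp [hωC, hωD]
  refine Lp.ext ((hL.mulShift_ae_eq hgen _ _).trans ?_)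
  refine ((indicatorConstLp_coeFn (hs := hL.measurable_incrPath 0 (Set.Iic s) hC)
    (hμs := measure_ne_top P _)).mul hshift).trans ?_
  rw [hprod]
  exact indicatorConstLp_coeFn.symm

theorem eq_top_of_mulFibre_mem {s t : ℝ≥0} (V : Submodule ℂ (L2Sub P (sigmaPast L P (s + t))))
    (hV : IsClosed (V : Set (L2Sub P (sigmaPast L P (s + t)))))
    (h : ∀ f g, hL.mulFibre hgen s t f g ∈ V) : V = ⊤ := by
  have hVc := (isClosed_L2Sub (P := P) (hL.sigmaPast_le (s + t))).isClosedEmbedding_subtypeVal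
    |>.isClosedMap _ hV
  have hle : L2Sub P (sigmaPast L P (s + t)) ≤
      V.map (L2Sub P (sigmaPast L P (s + t))).subtype := by
    refine L2Sub_le_of_indicatorL2_mem ((hL.measurable_incrPath 0 (Set.Iic s)).prodMk
      (hL.measurable_incrPath s (Set.Iic t))) (hL.sigmaPast_le _) (hL.sigmaPast_add_le s t)
      isPiSystem_prod generateFrom_prod.symm
      ⟨Set.univ, by simp, Set.univ, by simp, Set.univ_prod_univ⟩ hVc ?_
    rintro _ ⟨C, hC, D, hD, rfl⟩ _
    have hmem {r : ℝ≥0} {A : Set (Set.Iic r → B)} (hA : MeasurableSet A) :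
        indicatorL2 P (hL.measurable_incrPath 0 (Set.Iic r) hA) ∈ L2Sub P (sigmaPast L P r) := by
      have hmeas := measurable_sigmaPast_incrPath L P 0 r
      rw [zero_add] at hmeas
      exact mem_L2Sub_of_ae_eq (measurable_const.indicator (hmeas hA)) indicatorConstLp_coeFn
    exact ⟨_, h ⟨_, hmem hC⟩ ⟨_, hmem hD⟩, hL.mulShift_indicatorL2 hgen hC hD (hmem hC)⟩
  refine eq_top_iff.2 fun f _ => ?_
  obtain ⟨g, hg, hgf⟩ := hle f.2
  obtain rfl : g = f := Subtype.ext hgf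
  exact hg

theorem exists_levyMultiplication : ∃ U : ∀ s t : PosTime,
    HilbertTensor (levyFibre L P s) (levyFibre L P t) ≃ₗᵢ[ℂ] levyFibre L P (s + t),
    ∀ s t f g, (U s t (pureTensor f g) : Lp ℂ 2 P) = hL.mulShift hgen s f g := by
  have hex (s t : PosTime) : ∃ U :
      HilbertTensor (levyFibre L P s) (levyFibre L P t) ≃ₗᵢ[ℂ] levyFibre L P (s + t),
      ∀ f g, U (pureTensor f g) = hL.mulFibre hgen s t f g :=
    have : CompleteSpace (L2Sub P (sigmaPast L P ((s : ℝ≥0) + t))) :=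
      (isClosed_L2Sub (hL.sigmaPast_le _)).completeSpace_coe
    exists_hilbertTensor_equiv (hL.mulFibre hgen s t)
      (fun f f' g g' => hL.inner_mulShift hgen f f' g g')
      fun V hV h => hL.eq_top_of_mulFibre_mem hgen V hV h
  choose U hU using hex
  exact ⟨U, fun s t f g => congrArg Subtype.val (hU s t f g)⟩

theorem isLevyMultiplication_iff {U : ∀ s t : PosTime,
    HilbertTensor (levyFibre L P s) (levyFibre L P t) ≃ₗᵢ[ℂ] levyFibre L P (s + t)} :
    IsLevyMultiplication L P (hL.shiftFamily hgen) U ↔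
      ∀ s t f g, (U s t (pureTensor f g) : Lp ℂ 2 P) = hL.mulShift hgen s f g := by
  refine forall₄_congr fun s t f g => ⟨fun h => ?_, fun h => ?_⟩
  · exact Lp.ext (h.trans (hL.mulShift_ae_eq hgen f g).symm)
  · exact h ▸ hL.mulShift_ae_eq hgen f g

theorem mulShift_assoc {r s : ℝ≥0} (f : L2Sub P (sigmaPast L P r)) (g : L2Sub P (sigmaPast L P s))
    (h : Lp ℂ 2 P) : hL.mulShift hgen r f (hL.mulShift hgen s g h) =
      hL.mulShift hgen (r + s) (hL.mulFibre hgen r s f g) h := by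
  refine Lp.ext ((hL.mulShift_ae_eq hgen _ _).trans
    (EventuallyEq.trans ?_ (hL.mulShift_ae_eq hgen _ _).symm))
  rw [mulFibre_coe, ← shift_shift]
  refine (EventuallyEq.mul .rfl (hL.shift_mul hgen r (hL.mulShift_ae_eq hgen g h))).trans ?_
  rw [← mul_assoc]
  exact (hL.mulShift_ae_eq hgen f g).symm.mul .rfl

theorem bundleMul_assoc {U : ∀ s t : PosTime,
    HilbertTensor (levyFibre L P s) (levyFibre L P t) ≃ₗᵢ[ℂ] levyFibre L P (s + t)}
    (hU : ∀ s t f g, (U s t (pureTensor f g) : Lp ℂ 2 P) = hL.mulShift hgen s f g)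
    (a b c : TotalSpace (levyFibre L P)) :
    bundleMul U a (bundleMul U b c) = bundleMul U (bundleMul U a b) c := by
  have hext {x y : TotalSpace (levyFibre L P)} (ht : x.time = y.time)
      (hv : (x.vec : Lp ℂ 2 P) = y.vec) : x = y := by
    obtain ⟨t, x⟩ := x
    obtain ⟨_, y⟩ := y
    obtain rfl : t = _ := ht
    exact congrArg _ (Subtype.ext hv)
  refine hext (add_assoc _ _ _).symm ?_
  simp only [bundleMul, hU]
  rw [mulShift_assoc]
  congr 2
  exact (Subtype.ext (hU _ _ _ _)).symm

end IsLevyProcess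

end Multiplication

section SeparableHilbertSpaces

open Submodule InnerProductSpace TopologicalSpace

variable {α ι 𝕜 H : Type*} [RCLike 𝕜] [NormedAddCommGroup H] [InnerProductSpace 𝕜 H]

theorem countable_of_orthonormal [SeparableSpace H] {v : ι → H} (hv : Orthonormal 𝕜 v) :
    Countable ι := by
  refine Pairwise.countable_of_isOpen_disjoint (s := fun i => Metric.ball (v i) (1 / 2))
    (fun i j hij => Metric.ball_disjoint_ball ?_)
    (fun i => Metric.isOpen_ball) fun i => ⟨v i, Metric.mem_ball_self (by norm_num)⟩
  have h : ‖v i - v j‖ ^ 2 = 2 := by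
    rw [@norm_sub_sq 𝕜, hv.1 i, hv.1 j, hv.2 hij]
    norm_num
  rw [dist_eq_norm]
  nlinarith [norm_nonneg (v i - v j)]

theorem separableSpace_of_hilbertBasis [Countable ι] (b : HilbertBasis ι 𝕜 H) :
    SeparableSpace H := by
  have h := ((Set.countable_range b).isSeparable.span (R := 𝕜)).closure
  rw [← topologicalClosure_coe, b.dense_span] at h
  exact isSeparable_univ_iff.1 h

theorem infinite_setOf_ne_zero (hH : ¬ FiniteDimensional 𝕜 H) {v : ℕ → H}
    (hv : Dense (span 𝕜 (Set.range v) : Set H)) : {k | v k ≠ 0}.Infinite := by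
  intro hfin
  have hspan : span 𝕜 (Set.range v) = span 𝕜 (v '' {k | v k ≠ 0}) := by
    rw [← span_sdiff_singleton_zero]
    congr 1
    ext x
    aesop
  have hfd : FiniteDimensional 𝕜 (span 𝕜 (Set.range v)) := by
    rw [hspan]
    exact FiniteDimensional.span_of_finite 𝕜 (hfin.image _)
  refine hH (Module.finite_def.2 ?_)
  rw [← dense_iff_topologicalClosure_eq_top.1 hv,
    (closed_of_finiteDimensional _).submodule_topologicalClosure_eq]
  exact (fg_iff_finiteDimensional _).2 hfd

/-- Discarding the zero vectors that Gram–Schmidt leaves at linearly dependent entries. -/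
theorem exists_hilbertBasis_eq_gramSchmidtNormed [CompleteSpace H]
    (hH : ¬ FiniteDimensional 𝕜 H) {f : ℕ → H} (hf : DenseRange f) :
    {k | gramSchmidtNormed 𝕜 f k ≠ 0}.Infinite ∧ ∃ b : HilbertBasis ℕ 𝕜 H,
      ∀ n, b n = gramSchmidtNormed 𝕜 f (Nat.nth (fun k => gramSchmidtNormed 𝕜 f k ≠ 0) n) := by
  set v := gramSchmidtNormed 𝕜 f
  have hdense : Dense (span 𝕜 (Set.range v) : Set H) := by
    rw [span_gramSchmidtNormed_range, span_gramSchmidt]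
    exact hf.mono subset_span
  have hinf := infinite_setOf_ne_zero hH hdense
  have hv : Orthonormal 𝕜 fun n => v (Nat.nth (fun k => v k ≠ 0) n) :=
    (gramSchmidtNormed_orthonormal' (𝕜 := 𝕜) f).comp
      (fun n => ⟨_, Nat.nth_mem_of_infinite hinf n⟩)
      fun m n hmn => Nat.nth_injective hinf (congrArg Subtype.val hmn)
  have hspan : span 𝕜 (Set.range v) ≤
      span 𝕜 (Set.range fun n => v (Nat.nth (fun k => v k ≠ 0) n)) := by
    rw [span_le]
    rintro _ ⟨k, rfl⟩
    by_cases hk : v k = 0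
    · rw [hk]
      exact zero_mem _
    · obtain ⟨n, rfl⟩ : k ∈ Set.range (Nat.nth fun k => v k ≠ 0) :=
        (Nat.range_nth_of_infinite hinf).ge hk
      exact subset_span ⟨n, rfl⟩
  refine ⟨hinf, HilbertBasis.mk hv
    (top_le_iff.2 (dense_iff_topologicalClosure_eq_top.1 (hdense.mono hspan))), fun n => ?_⟩
  rw [HilbertBasis.coe_mk]

variable [MeasurableSpace α] [CompleteSpace H] [SecondCountableTopology H] [MeasurableSpace H]
  [BorelSpace H]

theorem measurable_of_measurable_inner {f : α → H} {D : Set H}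
    (hD : (span 𝕜 D).topologicalClosure = ⊤)
    (h : ∀ d ∈ D, Measurable fun a => inner 𝕜 d (f a)) : Measurable f := by
  have hspan : ∀ d ∈ span 𝕜 D, Measurable fun a => inner 𝕜 d (f a) := by
    intro d hd
    induction hd using span_induction with
    | mem d hd => exact h d hd
    | zero => simp
    | add x y _ _ hx hy => simpa only [inner_add_left] using! hx.add hy
    | smul c x _ hx => simpa only [inner_smul_left] using hx.const_mul _
  have hinner : ∀ d, Measurable fun a => inner 𝕜 d (f a) := by
    intro d
    obtain ⟨u, hu, hud⟩ := mem_closure_iff_seq_limit.1 ((eq_top_iff'.1 hD) d)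
    exact measurable_of_tendsto_metrizable (fun n => hspan _ (hu n))
      (tendsto_pi_nhds.2 fun a => hud.inner tendsto_const_nhds)
  obtain ⟨w, b, -⟩ := exists_hilbertBasis 𝕜 H
  have := countable_of_orthonormal b.orthonormal
  refine measurable_of_tendsto_metrizable' (u := (atTop : Filter (Finset w)))
    (f := fun s a => ∑ i ∈ s, b.repr (f a) i • b i) (fun s => ?_)
    (tendsto_pi_nhds.2 fun a => b.hasSum_repr (f a))
  refine Finset.measurable_fun_sum s fun i _ => Measurable.smul_const ?_ (b i)
  simpa only [b.repr_apply_apply] using hinner (b i)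

theorem measurable_of_measurable_hilbertBasis_repr (b : HilbertBasis ι 𝕜 H)
    {f : α → H} (h : ∀ i, Measurable fun a => b.repr (f a) i) : Measurable f := by
  refine measurable_of_measurable_inner (𝕜 := 𝕜) b.dense_span ?_
  rintro _ ⟨i, rfl⟩
  simpa only [b.repr_apply_apply] using h i

end SeparableHilbertSpaces

section MeasurableFamilies

open Submodule InnerProductSpace TopologicalSpace

variable {α 𝕜 H : Type*} [MeasurableSpace α] [RCLike 𝕜] [NormedAddCommGroup H]
  [InnerProductSpace 𝕜 H] [MeasurableSpace H]

/-- A family of closed subspaces is measurable when their orthogonal projections depend measurably,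
in the strong sense, on the parameter. -/
def IsMeasurableFamily (E : α → Submodule 𝕜 H) [∀ t, (E t).HasOrthogonalProjection] : Prop :=
  ∀ x, Measurable fun t => (E t).starProjection x

variable [BorelSpace H] [SecondCountableTopology H]

theorem measurable_coe_gramSchmidt {E : α → Submodule 𝕜 H} {f : ∀ t, ℕ → E t}
    (hf : ∀ k, Measurable fun t => (f t k : H)) (k : ℕ) :
    Measurable fun t => ((gramSchmidt 𝕜 (f t) k : E t) : H) := by
  induction k using Nat.strong_induction_on with
  | _ k ih =>
    have hrec : (fun t => ((gramSchmidt 𝕜 (f t) k : E t) : H)) = fun t => (f t k : H) -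
        ∑ i ∈ Finset.Iio k, (inner 𝕜 ((gramSchmidt 𝕜 (f t) i : E t) : H) (f t k) /
          ((‖((gramSchmidt 𝕜 (f t) i : E t) : H)‖ ^ 2 : ℝ) : 𝕜)) •
            ((gramSchmidt 𝕜 (f t) i : E t) : H) := by
      funext t
      rw [gramSchmidt_def]
      simp [starProjection_singleton]
    rw [hrec]
    refine (hf k).sub (Finset.measurable_fun_sum _ fun i hi => ?_)
    have hi' := ih i (Finset.mem_Iio.1 hi)
    exact ((hi'.inner (hf k)).div
      (RCLike.measurable_ofReal.comp (hi'.norm.pow_const 2))).smul hi'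

theorem measurable_coe_gramSchmidtNormed {E : α → Submodule 𝕜 H} {f : ∀ t, ℕ → E t}
    (hf : ∀ k, Measurable fun t => (f t k : H)) (k : ℕ) :
    Measurable fun t => ((gramSchmidtNormed 𝕜 (f t) k : E t) : H) := by
  have h := measurable_coe_gramSchmidt hf k
  exact (RCLike.measurable_ofReal.comp h.norm).inv.smul h

theorem measurable_nth {p : α → ℕ → Prop} (hp : ∀ k, MeasurableSet {t | p t k})
    (hinf : ∀ t, {k | p t k}.Infinite) (n : ℕ) : Measurable fun t => Nat.nth (p t) n := by
  classical
  have hcount : ∀ k, Measurable fun t => Nat.count (p t) k := by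
    intro k
    induction k with
    | zero => simp
    | succ k ih =>
      simp only [Nat.count_succ]
      exact ih.add (Measurable.ite (hp k) measurable_const measurable_const)
  refine measurable_to_countable' fun k => ?_
  have hpreimage : (fun t => Nat.nth (p t) n) ⁻¹' {k} =
      {t | p t k} ∩ (fun t => Nat.count (p t) k) ⁻¹' {n} := by
    ext t
    constructor
    · rintro rfl
      exact ⟨Nat.nth_mem_of_infinite (hinf t) n, Nat.count_nth_of_infinite (hinf t) n⟩
    · rintro ⟨hk, rfl⟩
      exact Nat.nth_count hk
  rw [hpreimage]
  exact (hp k).inter (hcount k (measurableSet_singleton n))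

variable (E : α → Submodule 𝕜 H)

theorem isMeasurableFamily_of_measurable_norm [CompleteSpace H]
    [∀ t, (E t).HasOrthogonalProjection]
    (h : ∀ x, Measurable fun t => ‖(E t).starProjection x‖) : IsMeasurableFamily E := by
  intro x
  refine measurable_of_measurable_inner (𝕜 := 𝕜) (D := Set.univ)
    (by rw [span_univ, isClosed_univ.submodule_topologicalClosure_eq]) fun d _ => ?_
  have hproj : ∀ t, inner 𝕜 d ((E t).starProjection x) =
      inner 𝕜 ((E t).starProjection d) ((E t).starProjection x) := fun t => by
    rw [inner_starProjection_left_eq_right, starProjection_apply,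
      starProjection_eq_self_iff.2 (Subtype.mem _)]
  simp only [hproj, inner_eq_sum_norm_sq_div_four, ← map_add, ← map_sub, ← map_smul]
  have hnorm : ∀ x, Measurable fun t => ((‖(E t).starProjection x‖ : ℝ) : 𝕜) := fun x =>
    RCLike.measurable_ofReal.comp (h x)
  exact ((((hnorm _).pow_const 2).sub ((hnorm _).pow_const 2)).add
    ((((hnorm _).pow_const 2).sub ((hnorm _).pow_const 2)).mul_const _)).div_const _

theorem isMeasurableFamily_of_monotone [CompleteSpace H] [∀ t, (E t).HasOrthogonalProjection]
    [LinearOrder α] [TopologicalSpace α] [OrderClosedTopology α] [BorelSpace α]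
    (h : Monotone E) : IsMeasurableFamily E := by
  refine isMeasurableFamily_of_measurable_norm E fun x => Monotone.measurable fun s t hst => ?_
  rw [← starProjection_comp_starProjection_of_le (h hst)]
  exact norm_starProjection_apply_le _ _

variable {E}

theorem IsMeasurableFamily.measurableSet [∀ t, (E t).HasOrthogonalProjection]
    (h : IsMeasurableFamily E) : MeasurableSet {q : α × H | q.2 ∈ E q.1} := by
  have huncurry : Measurable (Function.uncurry fun (x : H) (t : α) => (E t).starProjection x) :=
    measurable_uncurry_of_continuous_of_measurable (fun t => ContinuousLinearMap.continuous _) h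
  have hproj : Measurable fun q : α × H => (E q.1).starProjection q.2 := by
    simpa only [Function.comp_def, Function.uncurry, Prod.fst_swap, Prod.snd_swap] using
      huncurry.comp measurable_swap
  have hfix : {q : α × H | q.2 ∈ E q.1} = {q : α × H | (E q.1).starProjection q.2 = q.2} :=
    Set.ext fun q => starProjection_eq_self_iff.symm
  rw [hfix]
  exact measurableSet_eq_fun hproj measurable_snd

theorem IsMeasurableFamily.exists_hilbertBasis [∀ t, CompleteSpace (E t)]
    (h : IsMeasurableFamily E) (hE : ∀ t, ¬ FiniteDimensional 𝕜 (E t)) :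
    ∃ b : ∀ t, HilbertBasis ℕ 𝕜 (E t), ∀ n, Measurable fun t => (b t n : H) := by
  set f : ∀ t, ℕ → E t := fun t k => (E t).orthogonalProjectionOnto (denseSeq H k)
  have hdense : ∀ t, DenseRange (f t) := fun t =>
    have hsurj : Function.Surjective (E t).orthogonalProjectionOnto := fun v =>
      ⟨v, orthogonalProjectionOnto_mem_subspace_eq_self v⟩
    hsurj.denseRange.comp (denseRange_denseSeq H) (ContinuousLinearMap.continuous _)
  have hv : ∀ k, Measurable fun t => ((gramSchmidtNormed 𝕜 (f t) k : E t) : H) :=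
    measurable_coe_gramSchmidtNormed fun k => h (denseSeq H k)
  choose hinf b hb using fun t => exists_hilbertBasis_eq_gramSchmidtNormed (hE t) (hdense t)
  refine ⟨b, fun n => ?_⟩
  have hne : ∀ k, MeasurableSet {t | gramSchmidtNormed 𝕜 (f t) k ≠ 0} := fun k => by
    simp only [ne_eq, ← ZeroMemClass.coe_eq_zero]
    exact (measurableSet_eq_fun (hv k) measurable_const).compl
  have huncurry : Measurable fun q : α × ℕ =>
      ((gramSchmidtNormed 𝕜 (f q.1) q.2 : E q.1) : H) := measurable_from_prod_countable_left hv
  have hnth := (measurable_id (α := α)).prodMk (measurable_nth hne hinf n)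
  simpa only [hb, Function.comp_def, id_eq] using huncurry.comp hnth

end MeasurableFamilies

section Trivialization

instance secondCountableTopology_ell2 : SecondCountableTopology Ell2 :=
  have := separableSpace_of_hilbertBasis (HilbertBasis.ofRepr (.refl ℂ Ell2))
  UniformSpace.secondCountable_of_separable _

theorem IsMeasurableFamily.exists_trivialization {α H : Type*} [MeasurableSpace α]
    [NormedAddCommGroup H] [InnerProductSpace ℂ H] [SecondCountableTopology H] [MeasurableSpace H]
    [BorelSpace H] {E : α → Submodule ℂ H} [∀ t, CompleteSpace (E t)]
    (h : IsMeasurableFamily E) (hE : ∀ t, ¬ FiniteDimensional ℂ (E t)) :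
    ∃ V : ∀ t, E t ≃ₗᵢ[ℂ] Ell2,
      Measurable fun q : {q : α × H // q.2 ∈ E q.1} => V q.1.1 ⟨q.1.2, q.2⟩ := by
  obtain ⟨b, hb⟩ := h.exists_hilbertBasis hE
  refine ⟨fun t => (b t).repr,
    measurable_of_measurable_hilbertBasis_repr (.ofRepr (.refl ℂ Ell2)) fun n => ?_⟩
  simp only [LinearIsometryEquiv.coe_refl, id_eq, HilbertBasis.repr_apply_apply,
    Submodule.coe_inner]
  exact ((hb n).comp (measurable_fst.comp measurable_subtype_coe)).inner
    (measurable_snd.comp measurable_subtype_coe)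

theorem standardBorelSpace_of_measurableEquiv {α β : Type*} [MeasurableSpace α]
    [MeasurableSpace β] [StandardBorelSpace β] (e : α ≃ᵐ β) : StandardBorelSpace α := by
  obtain ⟨_, hβ, _⟩ := StandardBorelSpace.polish (α := β)
  let _ : TopologicalSpace α := .induced e inferInstance
  have hcomap (m : MeasurableSpace β) (hm : m = borel β) : m.comap e = borel α := by
    rw [hm, borel_comap]
  have : BorelSpace α :=
    ⟨e.measurableEmbedding.comap_eq.symm.trans (hcomap _ hβ.measurable_eq)⟩
  exact ⟨_, this, e.toEquiv.polishSpace_induced⟩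

end Trivialization

section TotalSpace

variable {Ω B : Type*} [MeasurableSpace Ω] [MeasurableSpace B] {P : Measure Ω} {L : ℝ≥0 → Ω → B}

theorem measurable_totalSpace_iff {β : Type*} [MeasurableSpace β]
    {f : β → TotalSpace (levyFibre L P)} :
    Measurable f ↔ Measurable (fun b => (f b).time) ∧
      Measurable (fun b => ((f b).vec : Lp ℂ 2 P)) := by
  rw [measurable_comap_iff]
  exact ⟨fun h => ⟨h.fst, h.snd⟩, fun h => h.1.prodMk h.2⟩

theorem measurable_totalSpace_time :
    Measurable (TotalSpace.time : TotalSpace (levyFibre L P) → PosTime) :=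
  (measurable_totalSpace_iff.1 measurable_id).1

theorem measurable_totalSpace_vec :
    Measurable fun x : TotalSpace (levyFibre L P) => (x.vec : Lp ℂ 2 P) :=
  (measurable_totalSpace_iff.1 measurable_id).2

theorem measurable_fibrePairs_left : Measurable fun q : FibrePairs (levyFibre L P) =>
    (⟨q.time, q.left⟩ : TotalSpace (levyFibre L P)) :=
  (comap_measurable _).fst

theorem measurable_fibrePairs_right : Measurable fun q : FibrePairs (levyFibre L P) =>
    (⟨q.time, q.right⟩ : TotalSpace (levyFibre L P)) :=
  (comap_measurable _).snd

variable (P L) in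
/-- The total space of the Lévy bundle as a subset of `(0, ∞) × L²(Ω, P)`. -/
def totalSpaceEquiv : TotalSpace (levyFibre L P) ≃ᵐ
    {q : PosTime × Lp ℂ 2 P // q.2 ∈ L2Sub P (sigmaPast L P q.1)} where
  toFun x := ⟨(x.time, x.vec), x.vec.2⟩
  invFun q := ⟨q.1.1, q.1.2, q.2⟩
  left_inv _ := rfl
  right_inv _ := rfl
  measurable_toFun :=
    (measurable_totalSpace_time.prodMk measurable_totalSpace_vec).subtype_mk
  measurable_invFun := measurable_totalSpace_iff.2
    ⟨measurable_fst.comp measurable_subtype_coe, measurable_snd.comp measurable_subtype_coe⟩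

end TotalSpace

section LevyBundle

theorem L2Sub_sigmaPast_mono {Ω B : Type*} [MeasurableSpace Ω] [MeasurableSpace B]
    (L : ℝ≥0 → Ω → B) (P : Measure Ω) : Monotone fun t => L2Sub P (sigmaPast L P t) :=
  fun _ _ h _ hf => mem_lpMeas_iff_aestronglyMeasurable.2
    ((mem_lpMeas_iff_aestronglyMeasurable.1 hf).mono (sigmaPast_mono L P h))

theorem continuous_setIntegral_mul {Ω : Type*} [MeasurableSpace Ω] {P : Measure Ω} (A : Set Ω) :
    Continuous fun q : Lp ℂ 2 P × Lp ℂ 2 P => ∫ ω in A, q.1 ω * q.2 ω ∂P := by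
  let T : Lp ℂ 2 P →L[ℂ] Lp ℂ 2 P →L[ℂ] Lp ℂ 1 P := (ContinuousLinearMap.mul ℂ ℂ).holderL P 2 2 1
  have hT (f g : Lp ℂ 2 P) : ∫ ω in A, f ω * g ω ∂P = ∫ ω in A, T f g ω ∂P :=
    (integral_congr_ae (ae_restrict_of_ae
      ((ContinuousLinearMap.mul ℂ ℂ).coeFn_holder (r := 1) f g))).symm
  simp only [hT]
  have hint : Continuous fun h : Lp ℂ 1 P => ∫ ω in A, h ω ∂P := continuous_setIntegral A
  exact hint.comp T.continuous₂

theorem topologicalClosure_span_indicatorL2 {Ω : Type*} [mΩ : MeasurableSpace Ω]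
    (P : Measure Ω) [IsFiniteMeasure P] :
    (Submodule.span ℂ {d | ∃ (A : Set Ω) (hA : MeasurableSet A),
      d = indicatorL2 P hA}).topologicalClosure = ⊤ := by
  refine top_le_iff.1 fun f _ => L2Sub_le_of_indicatorL2_mem (Y := id) measurable_id le_rfl ?_
    MeasurableSpace.isPiSystem_measurableSet MeasurableSpace.generateFrom_measurableSet.symm
    MeasurableSet.univ (Submodule.isClosed_topologicalClosure _) (fun C _ hC => ?_)
    (mem_lpMeas_self P f)
  · exact MeasurableSpace.comap_id.symm.trans_le le_eventuallyMeasurableSpace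
  · exact Submodule.le_topologicalClosure _ (Submodule.subset_span ⟨C, hC, rfl⟩)

namespace IsLevyProcess

theorem completeSpace_levyFibre {Ω B : Type*} [MeasurableSpace Ω] [NormedAddCommGroup B]
    [MeasurableSpace B] {P : Measure Ω} {L : ℝ≥0 → Ω → B} (hL : IsLevyProcess L P) (t : PosTime) :
    CompleteSpace (levyFibre L P t) :=
  (isClosed_L2Sub (P := P) (hL.sigmaPast_le _)).completeSpace_coe

variable {Ω B : Type*} [mΩ : MeasurableSpace Ω] [NormedAddCommGroup B] [CompleteSpace B]
  [MeasurableSpace B] [BorelSpace B] [SecondCountableTopology B] {P : Measure Ω}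
  {L : ℝ≥0 → Ω → B}

section FiniteMeasure

variable [IsFiniteMeasure P] (hL : IsLevyProcess L P) (hgen : mΩ = sigmaAll L)

include hL hgen

theorem secondCountableTopology_L2 : SecondCountableTopology (Lp ℂ 2 P) :=
  have := hL.separableSpace_L2 hgen
  UniformSpace.secondCountable_of_separable _

theorem isMeasurableFamily_levyFibre
    [∀ t : PosTime, (L2Sub P (sigmaPast L P t)).HasOrthogonalProjection] :
    IsMeasurableFamily fun t : PosTime => L2Sub P (sigmaPast L P t) :=
  have := hL.secondCountableTopology_L2 hgen
  isMeasurableFamily_of_monotone _ fun _ _ h => L2Sub_sigmaPast_mono L P h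

theorem standardBorelSpace_totalSpace : StandardBorelSpace (TotalSpace (levyFibre L P)) :=
  have := hL.secondCountableTopology_L2 hgen
  have := hL.completeSpace_levyFibre
  have : StandardBorelSpace PosTime := (measurableSet_Ioi (a := (0 : ℝ≥0))).standardBorel
  have : StandardBorelSpace {q : PosTime × Lp ℂ 2 P // q.2 ∈ L2Sub P (sigmaPast L P q.1)} :=
    (hL.isMeasurableFamily_levyFibre hgen).measurableSet.standardBorel
  standardBorelSpace_of_measurableEquiv (totalSpaceEquiv P L)

theorem measurableEmbedding_mk (t : PosTime) :
    @MeasurableEmbedding (levyFibre L P t) (TotalSpace (levyFibre L P)) (borel _) _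
      (TotalSpace.mk t) := by
  have := hL.secondCountableTopology_L2 hgen
  have := hL.completeSpace_levyFibre t
  have := hL.standardBorelSpace_totalSpace hgen
  borelize (levyFibre L P t)
  refine Measurable.measurableEmbedding ?_ fun x y hxy => ?_
  · exact measurable_totalSpace_iff.2 ⟨measurable_const, continuous_subtype_val.measurable⟩
  · simpa using hxy

end FiniteMeasure

variable [IsProbabilityMeasure P] (hL : IsLevyProcess L P) (hgen : mΩ = sigmaAll L)

theorem measurable_bundleMul {U : ∀ s t : PosTime,
    HilbertTensor (levyFibre L P s) (levyFibre L P t) ≃ₗᵢ[ℂ] levyFibre L P (s + t)}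
    (hU : ∀ s t f g, (U s t (pureTensor f g) : Lp ℂ 2 P) = hL.mulShift hgen s f g) :
    Measurable fun q : TotalSpace (levyFibre L P) × TotalSpace (levyFibre L P) =>
      bundleMul U q.1 q.2 := by
  have := hL.secondCountableTopology_L2 hgen
  have htime : Measurable fun x : TotalSpace (levyFibre L P) => (x.time : ℝ≥0) :=
    measurable_subtype_coe.comp measurable_totalSpace_time
  have hshift : Measurable fun q : TotalSpace (levyFibre L P) × TotalSpace (levyFibre L P) =>
      hL.shift hgen q.1.time q.2.vec := by
    simpa only [Function.comp_def] using (hL.continuous_shift hgen).measurable.comp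
      ((htime.comp measurable_fst).prodMk (measurable_totalSpace_vec.comp measurable_snd))
  refine measurable_totalSpace_iff.2
    ⟨((htime.comp measurable_fst).add (htime.comp measurable_snd)).subtype_mk, ?_⟩
  simp only [bundleMul, hU]
  refine measurable_of_measurable_inner (topologicalClosure_span_indicatorL2 P) ?_
  rintro _ ⟨A, hA, rfl⟩
  simp only [inner_indicatorL2_mulShift]
  exact (continuous_setIntegral_mul A).measurable.comp
    ((measurable_totalSpace_vec.comp measurable_fst).prodMk hshift)

theorem isMultiplicativeBundle {U : ∀ s t : PosTime,
    HilbertTensor (levyFibre L P s) (levyFibre L P t) ≃ₗᵢ[ℂ] levyFibre L P (s + t)}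
    (hU : ∀ s t f g, (U s t (pureTensor f g) : Lp ℂ 2 P) = hL.mulShift hgen s f g) :
    IsMultiplicativeBundle U :=
  have := hL.secondCountableTopology_L2 hgen
  have htime : Measurable fun q : FibrePairs (levyFibre L P) => q.time :=
    measurable_totalSpace_time.comp measurable_fibrePairs_left
  have htime' : Measurable fun q : ℂ × TotalSpace (levyFibre L P) => q.2.time :=
    measurable_totalSpace_time.comp measurable_snd
  have hleft := measurable_totalSpace_vec.comp (measurable_fibrePairs_left (L := L) (P := P))
  have hright := measurable_totalSpace_vec.comp (measurable_fibrePairs_right (L := L) (P := P))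
  { complete := hL.completeSpace_levyFibre
    separable := fun _ => inferInstance
    standardBorel := hL.standardBorelSpace_totalSpace hgen
    measurable_time := measurable_totalSpace_time
    fibre_embedding := hL.measurableEmbedding_mk hgen
    measurable_smul := measurable_totalSpace_iff.2
      ⟨htime', measurable_fst.smul (measurable_totalSpace_vec.comp measurable_snd)⟩
    measurable_add := measurable_totalSpace_iff.2
      ⟨htime, hleft.add hright⟩
    measurable_inner := hleft.inner hright
    measurable_mul := hL.measurable_bundleMul hgen hU
    assoc := hL.bundleMul_assoc hgen hU }

end IsLevyProcess

end LevyBundle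

section ExponentialUnits

open BoundedContinuousFunction (probCharDual probCharDual_apply)

theorem probCharDual_add {E : Type*} [SeminormedAddCommGroup E] [NormedSpace ℝ E]
    (φ : StrongDual ℝ E) (x y : E) :
    probCharDual φ (x + y) = probCharDual φ x * probCharDual φ y := by
  simp only [probCharDual_apply, map_add, Complex.ofReal_add, add_mul, Complex.exp_add]

theorem norm_probCharDual {E : Type*} [SeminormedAddCommGroup E] [NormedSpace ℝ E]
    (φ : StrongDual ℝ E) (x : E) : ‖probCharDual φ x‖ = 1 :=
  Complex.norm_exp_ofReal_mul_I _

namespace IsLevyProcess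

variable {Ω B : Type*} [mΩ : MeasurableSpace Ω] [NormedAddCommGroup B] [NormedSpace ℝ B]
  [MeasurableSpace B] [BorelSpace B] {P : Measure Ω} {L : ℝ≥0 → Ω → B}

section FiniteMeasure

variable [IsFiniteMeasure P] (hL : IsLevyProcess L P) (φ : StrongDual ℝ B)

/-- The exponential `exp(i⟨φ, L_t⟩)` as an element of `L²(Ω, P)`. -/
noncomputable def expL2 (t : ℝ≥0) : Lp ℂ 2 P :=
  (memLp_boundedContinuous_comp (probCharDual φ) (hL.measurable t) 2).toLp _

theorem expL2_ae_eq (t : ℝ≥0) : hL.expL2 φ t =ᵐ[P] fun ω => probCharDual φ (L t ω) :=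
  MemLp.coeFn_toLp _

theorem expL2_mem (t : ℝ≥0) : hL.expL2 φ t ∈ L2Sub P (sigmaPast L P t) :=
  mem_L2Sub_of_ae_eq
    ((probCharDual φ).continuous.measurable.comp (measurable_sigmaPast L P le_rfl))
    (hL.expL2_ae_eq φ t)

theorem tendsto_expL2 : Tendsto (hL.expL2 φ) (𝓝 0) (𝓝 (hL.expL2 φ 0)) := by
  refine tendsto_toLp_boundedContinuous_comp (probCharDual φ) hL.measurable (hL.measurable 0) ?_
  filter_upwards [hL.cadlag] with ω hω
  have hIci : Set.Ici (0 : ℝ≥0) = Set.univ := Set.Ici_bot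
  simpa only [hIci, continuousWithinAt_univ, ContinuousAt] using (hω 0).1

end FiniteMeasure

variable [IsProbabilityMeasure P] (hL : IsLevyProcess L P) (φ : StrongDual ℝ B)

theorem norm_expL2 (t : ℝ≥0) : ‖hL.expL2 φ t‖ = 1 := by
  rw [expL2, Lp.norm_toLp, eLpNorm_congr_norm_ae (g := fun _ => (1 : ℂ))
    (.of_forall fun ω => by rw [norm_probCharDual, norm_one]),
    eLpNorm_const _ two_ne_zero (IsProbabilityMeasure.ne_zero P)]
  simp

variable [SecondCountableTopology B] (hgen : mΩ = sigmaAll L)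

theorem shift_expL2 (s t : ℝ≥0) :
    hL.shift hgen s (hL.expL2 φ t) =ᵐ[P] fun ω => probCharDual φ (L (s + t) ω - L s ω) := by
  let u : Set.Iic t := ⟨t, Set.mem_Iic.2 le_rfl⟩
  have hcoord : Measurable fun x : ↥(Set.Iic t) → B => probCharDual φ (x u) :=
    (probCharDual φ).continuous.measurable.comp (measurable_pi_apply u)
  have hexp : hL.expL2 φ t =ᵐ[P] (fun x => probCharDual φ (x u)) ∘ incrPath L 0 (Set.Iic t) := by
    filter_upwards [hL.expL2_ae_eq φ t, hL.zero] with ω hω hzero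
    simp [hω, hzero, incrPath, u]
  simpa using! hL.shift_ae_eq hgen s hcoord hexp

theorem mulShift_expL2 (s t : ℝ≥0) :
    hL.mulShift hgen s ⟨hL.expL2 φ s, hL.expL2_mem φ s⟩ (hL.expL2 φ t) = hL.expL2 φ (s + t) := by
  refine Lp.ext ?_
  filter_upwards [hL.mulShift_ae_eq hgen ⟨hL.expL2 φ s, hL.expL2_mem φ s⟩ (hL.expL2 φ t),
    hL.expL2_ae_eq φ s, hL.expL2_ae_eq φ (s + t), hL.shift_expL2 φ hgen s t] with ω h hs hst hshift
  rw [h, Pi.mul_apply, hs, hst, hshift, ← probCharDual_add, add_sub_cancel]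

include hgen in
theorem continuous_expL2 : Continuous (hL.expL2 φ) := by
  refine continuous_of_dist_add_eq (fun s t => ?_) (hL.tendsto_expL2 φ)
  have hmul : hL.expL2 φ (s + t) - hL.expL2 φ s =
      hL.mulShift hgen s ⟨hL.expL2 φ s, hL.expL2_mem φ s⟩ (hL.expL2 φ t - hL.expL2 φ 0) := by
    rw [map_sub, mulShift_expL2, mulShift_expL2, add_zero]
  rw [dist_eq_norm, dist_eq_norm, hmul, norm_mulShift, Submodule.coe_norm, norm_expL2, one_mul]

theorem isProductUnit_expL2 {U : ∀ s t : PosTime,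
    HilbertTensor (levyFibre L P s) (levyFibre L P t) ≃ₗᵢ[ℂ] levyFibre L P (s + t)}
    (hU : ∀ s t f g, (U s t (pureTensor f g) : Lp ℂ 2 P) = hL.mulShift hgen s f g) :
    IsProductUnit U fun t : PosTime => ⟨hL.expL2 φ t, hL.expL2_mem φ t⟩ where
  measurable := measurable_totalSpace_iff.2 ⟨measurable_id,
    (hL.continuous_expL2 φ hgen).measurable.comp measurable_subtype_coe⟩
  ne_zero := ⟨⟨1, one_pos⟩, fun h => one_ne_zero <|
    (hL.norm_expL2 φ 1).symm.trans (norm_eq_zero.2 (congrArg Subtype.val h))⟩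
  mul s t := Subtype.ext <| by
    rw [hU]
    exact (hL.mulShift_expL2 φ hgen s t).symm

end IsLevyProcess

end ExponentialUnits

section Dimension

theorem finrank_mul_finrank_le_of_hilbertTensor {H K M : Type*} [NormedAddCommGroup H]
    [InnerProductSpace ℂ H] [NormedAddCommGroup K] [InnerProductSpace ℂ K] [NormedAddCommGroup M]
    [InnerProductSpace ℂ M] [FiniteDimensional ℂ M] (U : HilbertTensor H K →ₗᵢ[ℂ] M) :
    Module.finrank ℂ H * Module.finrank ℂ K ≤ Module.finrank ℂ M := by
  rw [← Module.finrank_tensorProduct (R := ℂ) (S := ℂ)]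
  let J : H ⊗[ℂ] K →ₗᵢ[ℂ] M := U.comp UniformSpace.Completion.toComplₗᵢ
  exact LinearMap.finrank_le_finrank_of_injective (f := J.toLinearMap) J.injective

theorem eq_zero_or_eq_zero_of_inner_eq_zero_of_finrank_le_one {𝕜 H : Type*} [RCLike 𝕜]
    [NormedAddCommGroup H] [InnerProductSpace 𝕜 H] [FiniteDimensional 𝕜 H]
    (h : Module.finrank 𝕜 H ≤ 1) {x y : H} (hxy : inner 𝕜 x y = 0) : x = 0 ∨ y = 0 := by
  obtain ⟨v, hv⟩ := finrank_le_one_iff.1 h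
  obtain ⟨a, rfl⟩ := hv x
  obtain ⟨b, rfl⟩ := hv y
  simp only [inner_smul_left, inner_smul_right, mul_eq_zero, map_eq_zero, inner_self_eq_zero]
    at hxy
  simp only [smul_eq_zero]
  tauto

theorem measure_eq_zero_or_measure_compl_eq_zero_of_finrank_le_one {Ω : Type*}
    {m mΩ : MeasurableSpace Ω} (hm : m ≤ mΩ) {P : Measure Ω} [IsFiniteMeasure P]
    [FiniteDimensional ℂ (L2Sub P m)] (h : Module.finrank ℂ (L2Sub P m) ≤ 1) {A : Set Ω}
    (hA : MeasurableSet[m] A) : P A = 0 ∨ P Aᶜ = 0 := by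
  have hmem {C : Set Ω} (hC : MeasurableSet[m] C) : indicatorL2 P (hm C hC) ∈ L2Sub P m :=
    mem_L2Sub_of_ae_eq (measurable_const.indicator hC) indicatorConstLp_coeFn
  have hzero {C : Set Ω} (hC : MeasurableSet[m] C)
      (h0 : (⟨_, hmem hC⟩ : L2Sub P m) = 0) : P C = 0 := by
    have hself : inner ℂ (indicatorL2 P (hm C hC)) (indicatorL2 P (hm C hC)) = (P.real C : ℂ) := by
      rw [L2.inner_indicatorConstLp_one_indicatorConstLp_one, Set.inter_self]
      rfl
    have hind : indicatorL2 P (hm C hC) = 0 := congrArg Subtype.val h0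
    rw [hind, inner_zero_left] at hself
    exact (measureReal_eq_zero_iff).1 (by exact_mod_cast hself.symm)
  have horth : inner ℂ (⟨_, hmem hA⟩ : L2Sub P m) ⟨_, hmem hA.compl⟩ = 0 := by
    rw [Submodule.coe_inner, L2.inner_indicatorConstLp_one_indicatorConstLp_one]
    simp
  exact (eq_zero_or_eq_zero_of_inner_eq_zero_of_finrank_le_one h horth).imp (hzero hA)
    (hzero hA.compl)

theorem exists_ae_eq_const_of_forall_measure_preimage {Ω E : Type*} [MeasurableSpace Ω]
    [MeasurableSpace E] [StandardBorelSpace E] {P : Measure Ω} [IsProbabilityMeasure P]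
    {X : Ω → E} (hX : Measurable X)
    (h : ∀ C, MeasurableSet C → P (X ⁻¹' C) = 0 ∨ P (X ⁻¹' C)ᶜ = 0) :
    ∃ b, ∀ᵐ ω ∂P, X ω = b := by
  have := Measure.isProbabilityMeasure_map (μ := P) hX.aemeasurable
  have : IsZeroOneMeasure (P.map X) := ⟨fun C hC => by
    simpa only [Measure.map_apply hX hC, prob_compl_eq_zero_iff (hX hC)] using h C hC⟩
  obtain ⟨b, hb⟩ := IsZeroOneMeasure.exists_eq_dirac (μ := P.map X)
  have hae : ∀ᵐ x ∂P.map X, x = b := by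
    rw [hb, ae_dirac_eq]
    exact rfl
  exact ⟨b, ae_of_ae_map hX.aemeasurable hae⟩

namespace IsLevyProcess

section Deterministic

variable {Ω B : Type*} [MeasurableSpace Ω] [NormedAddCommGroup B] [MeasurableSpace B]
  {P : Measure Ω} {L : ℝ≥0 → Ω → B} (hL : IsLevyProcess L P)

include hL

theorem exists_ae_eq_const_of_finrank_le_one [StandardBorelSpace B] [IsProbabilityMeasure P]
    {t : ℝ≥0} [FiniteDimensional ℂ (L2Sub P (sigmaPast L P t))]
    (h : Module.finrank ℂ (L2Sub P (sigmaPast L P t)) ≤ 1) : ∃ b, ∀ᵐ ω ∂P, L t ω = b :=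
  exists_ae_eq_const_of_forall_measure_preimage (hL.measurable t) fun _ hC =>
    measure_eq_zero_or_measure_compl_eq_zero_of_finrank_le_one (hL.sigmaPast_le t) h
      (measurable_sigmaPast L P le_rfl hC)

theorem exists_ae_eq_const_add_self [MeasurableSingletonClass B] {t : ℝ≥0}
    (h : ∃ b, ∀ᵐ ω ∂P, L t ω = b) : ∃ b, ∀ᵐ ω ∂P, L (t + t) ω = b := by
  obtain ⟨b, hb⟩ := h
  have hincr : ∀ᵐ ω ∂P, L (t + t) ω - L t ω = b :=
    (hL.stationary t t).symm.ae_snd (p := fun x => x = b) (measurableSet_singleton b) hb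
  refine ⟨b + b, ?_⟩
  filter_upwards [hincr, hb] with ω h2 h3
  rw [sub_eq_iff_eq_add.1 h2, h3]

theorem isDeterministicProcess_of_forall_le [MeasurableSingletonClass B] {r : ℝ≥0} (hr : 0 < r)
    (h : ∀ t ≤ r, ∃ b, ∀ᵐ ω ∂P, L t ω = b) : IsDeterministicProcess L P := by
  have hdouble (n : ℕ) : ∀ t ≤ 2 ^ n * r, ∃ b, ∀ᵐ ω ∂P, L t ω = b := by
    induction n with
    | zero => simpa using h
    | succ n ih =>
      intro t ht
      rw [pow_succ', mul_assoc] at ht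
      have hhalf := hL.exists_ae_eq_const_add_self (ih (t / 2) ((div_le_iff₀' two_pos).2 ht))
      rwa [add_halves] at hhalf
  intro t
  obtain ⟨n, hn⟩ := pow_unbounded_of_one_lt (t / r) (one_lt_two (α := ℝ≥0))
  exact hdouble n t ((div_le_iff₀ hr).1 hn.le)

end Deterministic

variable {Ω B : Type*} [mΩ : MeasurableSpace Ω] [NormedAddCommGroup B]
  [MeasurableSpace B] [BorelSpace B] [SecondCountableTopology B] {P : Measure Ω}
  [IsProbabilityMeasure P] {L : ℝ≥0 → Ω → B} (hL : IsLevyProcess L P) (hgen : mΩ = sigmaAll L)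

include hL hgen

theorem exists_finrank_levyFibre_le_one (d : ℕ) (t : PosTime)
    (hfin : FiniteDimensional ℂ (levyFibre L P t))
    (hd : Module.finrank ℂ (levyFibre L P t) ≤ d) :
    ∃ r : PosTime, FiniteDimensional ℂ (levyFibre L P r) ∧
      Module.finrank ℂ (levyFibre L P r) ≤ 1 := by
  induction d generalizing t with
  | zero => exact ⟨t, hfin, hd.trans zero_le_one⟩
  | succ d ih =>
    by_cases h1 : Module.finrank ℂ (levyFibre L P t) ≤ 1
    · exact ⟨t, hfin, h1⟩
    obtain ⟨r, rfl⟩ : ∃ r : PosTime, r + r = t :=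
      ⟨⟨t / 2, half_pos t.2⟩, Subtype.ext (add_halves _)⟩
    have hle : L2Sub P (sigmaPast L P r) ≤ L2Sub P (sigmaPast L P (r + r : PosTime)) :=
      L2Sub_sigmaPast_mono L P le_self_add
    have hfin' := Submodule.finiteDimensional_of_le hle
    obtain ⟨U, -⟩ := hL.exists_levyMultiplication hgen
    have hsq := finrank_mul_finrank_le_of_hilbertTensor (U r r).toLinearIsometry
    refine ih r hfin' ?_
    by_contra! hlt
    nlinarith

variable [CompleteSpace B]

theorem isDeterministicProcess_of_finiteDimensional {t : PosTime}
    (h : FiniteDimensional ℂ (levyFibre L P t)) : IsDeterministicProcess L P := by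
  obtain ⟨r, hr, hr1⟩ := hL.exists_finrank_levyFibre_le_one hgen _ t h le_rfl
  refine hL.isDeterministicProcess_of_forall_le r.2 fun u hu => ?_
  have hle : L2Sub P (sigmaPast L P u) ≤ L2Sub P (sigmaPast L P r) := L2Sub_sigmaPast_mono L P hu
  have := Submodule.finiteDimensional_of_le hle
  exact hL.exists_ae_eq_const_of_finrank_le_one ((Submodule.finrank_mono hle).trans hr1)

theorem exists_levyFibre_trivialization
    (hinf : ∀ t : PosTime, ¬ FiniteDimensional ℂ (levyFibre L P t)) :
    ∃ (V : ∀ t, levyFibre L P t ≃ₗᵢ[ℂ] Ell2)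
      (Φ : TotalSpace (levyFibre L P) ≃ᵐ PosTime × Ell2),
      ∀ x : TotalSpace (levyFibre L P), Φ x = (x.time, V x.time x.vec) := by
  have := hL.secondCountableTopology_L2 hgen
  have := hL.completeSpace_levyFibre
  have := hL.standardBorelSpace_totalSpace hgen
  obtain ⟨V, hV⟩ := (hL.isMeasurableFamily_levyFibre hgen).exists_trivialization hinf
  let Φ : TotalSpace (levyFibre L P) ≃ PosTime × Ell2 :=
    { toFun := fun x => (x.time, V x.time x.vec)
      invFun := fun q => ⟨q.1, (V q.1).symm q.2⟩
      left_inv := fun x => congrArg (TotalSpace.mk x.time) ((V x.time).symm_apply_apply x.vec)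
      right_inv := fun q => Prod.ext rfl ((V q.1).apply_symm_apply q.2) }
  have hΦ : Measurable Φ :=
    measurable_totalSpace_time.prodMk (hV.comp (totalSpaceEquiv P L).measurable)
  refine ⟨V, ⟨Φ, hΦ, fun s hs => ?_⟩, fun x => rfl⟩
  rw [← Equiv.image_eq_preimage_symm]
  exact (hΦ.measurableEmbedding Φ.injective).measurableSet_image.2 hs

theorem isProductSystem (hdet : ¬ IsDeterministicProcess L P) {U : ∀ s t : PosTime,
    HilbertTensor (levyFibre L P s) (levyFibre L P t) ≃ₗᵢ[ℂ] levyFibre L P (s + t)}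
    (hU : ∀ s t f g, (U s t (pureTensor f g) : Lp ℂ 2 P) = hL.mulShift hgen s f g) :
    IsProductSystem U :=
  have hinf (t : PosTime) (h : FiniteDimensional ℂ (levyFibre L P t)) : False :=
    hdet (hL.isDeterministicProcess_of_finiteDimensional hgen h)
  { hL.isMultiplicativeBundle hgen hU with
    infinite_dim := hinf
    trivializable := hL.exists_levyFibre_trivialization hgen hinf }

end IsLevyProcess

end Dimension

theorem mainTheorem2 {Ω B : Type*} [mΩ : MeasurableSpace Ω] [NormedAddCommGroup B]
    [NormedSpace ℝ B] [CompleteSpace B] [TopologicalSpace.SeparableSpace B]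
    [MeasurableSpace B] [BorelSpace B] (P : Measure Ω) [IsProbabilityMeasure P]
    (L : ℝ≥0 → Ω → B) (hL : IsLevyProcess L P) (hgen : mΩ = sigmaAll L) :
    ∃ S : ShiftFamily L P,
      -- the shift of cylindrical functions extends uniquely to unitaries
      (IsShiftFamily L P S ∧ ∀ S', IsShiftFamily L P S' → S' = S) ∧
      -- these are composition with the shift of the sample space, where there is one
      (∀ (s : ℝ≥0) (σ : Ω → Ω), MeasurePreserving σ P P →
        (∀ t, ∀ᵐ ω ∂P, L t (σ ω) = L (s + t) ω - L s ω) →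
        ∀ (t : ℝ≥0) (g : L2Sub P (sigmaPast L P t)),
          ((S s t g : Lp ℂ 2 P) : Ω → ℂ) =ᵐ[P] fun ω => ((g : Lp ℂ 2 P) : Ω → ℂ) (σ ω)) ∧
      -- the multiplication is a well-defined family of unitaries
      ∃ U : ∀ s t : PosTime,
          HilbertTensor (levyFibre L P s) (levyFibre L P t) ≃ₗᵢ[ℂ] levyFibre L P (s + t),
        (IsLevyMultiplication L P S U ∧ ∀ U', IsLevyMultiplication L P S U' → U' = U) ∧
        IsMultiplicativeBundle U ∧
        (∀ φ : StrongDual ℝ B, ∃ u : ∀ t : PosTime, levyFibre L P t,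
          (∀ t : PosTime, ((u t : Lp ℂ 2 P) : Ω → ℂ) =ᵐ[P]
            fun ω => Complex.exp (Complex.I * ((φ (L t ω) : ℝ) : ℂ))) ∧
          IsProductUnit U u) ∧
        (¬ IsDeterministicProcess L P → IsSpatialProductSystem U) := by
  have : SecondCountableTopology B := UniformSpace.secondCountable_of_separable B
  have hS := hL.isShiftFamily_shiftFamily hgen
  obtain ⟨U, hU⟩ := hL.exists_levyMultiplication hgen
  refine ⟨hL.shiftFamily hgen, ⟨hS, fun S' hS' => hL.eq_of_isShiftFamily hS hS'⟩,
    fun s σ hσ hLσ t g => ?_, U, ⟨(hL.isLevyMultiplication_iff hgen).2 hU, fun U' hU' => ?_⟩,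
    hL.isMultiplicativeBundle hgen hU,
    fun φ => ⟨_, fun t => ?_, hL.isProductUnit_expL2 φ hgen hU⟩,
    fun hdet =>
      { hL.isProductSystem hgen hdet hU with
        exists_unit := ⟨_, hL.isProductUnit_expL2 0 hgen hU⟩ }⟩
  · rw [hL.shiftFamily_coe, hL.shift_eq_pullbackL2 hgen s hσ hLσ g]
    exact pullbackL2_coeFn hσ _
  · have hU'' := (hL.isLevyMultiplication_iff hgen).1 hU'
    funext s t
    exact hilbertTensor_equiv_ext fun f g =>
      Subtype.ext ((hU'' s t f g).trans (hU s t f g).symm)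
  · simpa only [BoundedContinuousFunction.probCharDual_apply, mul_comm] using hL.expL2_ae_eq φ t
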